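/- Let $I=\,]0,1]$. A net $x:I\to\mathbb R$ is moderate if $|x_\varepsilon|<\varepsilon^{s}$ for some $s\in\mathbb R$ and all small $\varepsilon$, negligible if this holds for every $s\in\mathbb N$; $\overline{\mathbb R}$ is the ring of moderate nets modulo the ideal of negligible nets. The sharp norm of $x=[(x_\varepsilon)]\in\overline{\mathbb R}^m$ is $\|x\|=e^{-V(x)}$, $V(x)=\sup\{s\in\mathbb R:\ |x_\varepsilon|<\varepsilon^{s}\text{ for small }\varepsilon\}$; it defines the (sharp) topology of $\overline{\mathbb R}^m$. For $X\subset\mathbb R^m$, $\widetilde X_c\subset\overline{\mathbb R}^m$ is the set of classes $[(p_\varepsilon)]$ such that, for small $\varepsilon$, $p_\varepsilon$ stays in a fixed compact subset of $X$; for a net of subsets $B_\varepsilon\subset X$, the strongly internal set $\langle B_\varepsilon\rangle$ relative to $X$ is the set of those $p\in\widetilde X_c$ each of whose representatives $(p_\varepsilon)$ with values in $X$ satisfies $p_\varepsilon\in B_\varepsilon$ for small $\varepsilon$. A map $f$ from an open set $D\subset\overline{\mathbb R}^n$ to $\overline{\mathbb R}^m$ is differentiable at $x\in D$ if there is an $\overline{\mathbb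 R}$-linear map $L$ with $\|f(y)-f(x)-L(y-x)\|=o(\|y-x\|)$ as $y\to x$; it is $C^0$ if continuous, $C^{k+1}$ if differentiable on $D$ with partial derivatives of class $C^k$, and $C^\infty$ if $C^k$ for all $k$. Let $M\subset\mathbb R^N$ be an $n$-dimensional $C^\infty$ submanifold with an atlas $\{(U_\alpha,\phi_\alpha)\}_{\alpha\in\Lambda}$ such that, for a fixed $r>0$, $\phi_\alpha(U_\alpha)=\Omega_0=B_r(0)\subset\mathbb R^n$ for all $\alpha$, and such that every $\phi_\alpha$ and every $\phi_\alpha^{-1}$ is Lipschitz (with constants that may depend on $\alpha$). For $\lambda:I\to\Lambda$ let $U_\lambda=\langle U_{\lambda(\varepsilon)}\rangle$ be the strongly internal set relative to $M$, and let $\phi_\lambda([(p_\varepsilon)])=[(\phi_{\lambda(\varepsilon)}(p_\varepsilon))]$ on $U_\lambda$, for representatives with values in $M$. Let $\langle\Omega_0\rangle$ be the strongly internal set of the constant net $\Omega_0$, relative to $\mathbb R^n$. Then: 1. The topology induced on $\widetilde M_c$ by $\overline{\mathbb R}^N$ is the topology given by the charts: it is the unique topology of $\widetilde M_c$ for which every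 $\phi_\lambda$, $\lambda$ of finite range, is a homeomorphism of an open set $U_\lambda\subset\widetilde M_c$ onto an open subset of $\overline{\mathbb R}^n$. 2. If $\lambda$ has finite range, then $U_\lambda$ is an open subset of $\widetilde M_c$. 3. $\langle\Omega_0\rangle$ is an open subset of $\overline{\mathbb R}^n$ contained in $\widetilde{\mathbb R}^n_c$. 4. If $\lambda$ has finite range, then $\phi_\lambda$ is well defined, maps $U_\lambda$ into $\langle\Omega_0\rangle$, and is isometric: $\|\phi_\lambda(p)-\phi_\lambda(q)\|=\|p-q\|$ for $p,q\in U_\lambda$. If moreover each $U_{\lambda(\varepsilon)}$ is relatively compact in $M$, then $\phi_\lambda(U_\lambda)=\langle\Omega_0\rangle$. 5. $\widetilde M_c=\bigcup_\lambda U_\lambda$, the union over all $\lambda$ of finite range. 6. Let $\lambda_1,\lambda_2$ have finite range, and suppose that for each $\alpha$ in their ranges the derivatives of $\phi_\alpha^{-1}$ have moderate growth at the boundary of $\Omega_0$: for each $k$ there are $C,m$ with $\|D^k\phi_\alpha^{-1}(x)\|\le C\,(r-|x|)^{-m}$ on $\Omega_0$ (for example, $\phi_\alpha^{-1}$ extends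 smoothly to a neighbourhood of $\overline{\Omega_0}$). Then $\phi_{\lambda_2}\circ\phi_{\lambda_1}^{-1}$ is a $C^\infty$ diffeomorphism of the open set $\phi_{\lambda_1}(U_{\lambda_1}\cap U_{\lambda_2})$ onto the open set $\phi_{\lambda_2}(U_{\lambda_1}\cap U_{\lambda_2})$. -/

import Mathlib

open scoped ContDiff Topology

noncomputable section

/-! ## The ring of generalized numbers -/

/-- The index set `I = ]0,1]` of nets. -/
abbrev Idx : Type := Set.Ioc (0 : ℝ) 1

/-- `∀ᶠ ε in small, P ε` means: there is `η > 0` such that `P ε` for all `ε ∈ I` below `η`. -/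
def small : Filter Idx := Filter.comap (fun ε : Idx => (ε : ℝ)) (𝓝 0)

/-- `x` is moderate: `|x ε| < ε ^ r` for some real `r` and all small `ε`. -/
def IsModerate (x : Idx → ℝ) : Prop :=
  ∃ r : ℝ, ∀ᶠ ε : Idx in small, |x ε| < (ε : ℝ) ^ r

/-- `x` is negligible: for every natural `k`, `|x ε| < ε ^ k` for all small `ε`. -/
def IsNegligible (x : Idx → ℝ) : Prop :=
  ∀ k : ℕ, ∀ᶠ ε : Idx in small, |x ε| < (ε : ℝ) ^ k

theorem small_lt {η : ℝ} (h : 0 < η) : ∀ᶠ ε : Idx in small, (ε : ℝ) < η :=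
  Filter.preimage_mem_comap (Iio_mem_nhds h)

theorem IsModerate.add {x y : Idx → ℝ} (hx : IsModerate x) (hy : IsModerate y) :
    IsModerate (x + y) := by
  obtain ⟨r, hr⟩ := hx
  obtain ⟨s, hs⟩ := hy
  refine ⟨min r s - 1, ?_⟩
  filter_upwards [hr, hs, small_lt (η := 1 / 2) (by norm_num)] with ε h1 h2 h3
  have h0 : (0 : ℝ) < ε := ε.2.1
  have e1 : (ε : ℝ) ^ r ≤ (ε : ℝ) ^ min r s :=
    Real.rpow_le_rpow_of_exponent_ge h0 ε.2.2 (min_le_left _ _)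
  have e2 : (ε : ℝ) ^ s ≤ (ε : ℝ) ^ min r s :=
    Real.rpow_le_rpow_of_exponent_ge h0 ε.2.2 (min_le_right _ _)
  have e3 : (0 : ℝ) < (ε : ℝ) ^ min r s := Real.rpow_pos_of_pos h0 _
  rw [Real.rpow_sub_one h0.ne', lt_div_iff₀ h0]
  have h4 : |(x + y) ε| ≤ |x ε| + |y ε| := abs_add_le _ _
  nlinarith [abs_nonneg ((x + y) ε)]

theorem IsModerate.mul {x y : Idx → ℝ} (hx : IsModerate x) (hy : IsModerate y) :
    IsModerate (x * y) := by
  obtain ⟨r, hr⟩ := hx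
  obtain ⟨s, hs⟩ := hy
  refine ⟨r + s, ?_⟩
  filter_upwards [hr, hs] with ε h1 h2
  rw [Real.rpow_add ε.2.1, Pi.mul_apply, abs_mul]
  exact mul_lt_mul'' h1 h2 (abs_nonneg _) (abs_nonneg _)

theorem isModerate_const (c : ℝ) : IsModerate (fun _ => c) := by
  refine ⟨-1, ?_⟩
  have hc : 0 < 1 / (|c| + 1) := by positivity
  filter_upwards [small_lt hc] with ε h
  have h0 : (0 : ℝ) < ε := ε.2.1
  rw [lt_div_iff₀ (by positivity)] at h
  rw [Real.rpow_neg_one, ← one_div, lt_div_iff₀ h0]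
  nlinarith

/-- The ring of moderate nets of real numbers. -/
def moderateNets : Subring (Idx → ℝ) where
  carrier := {x | IsModerate x}
  mul_mem' hx hy := IsModerate.mul hx hy
  add_mem' hx hy := IsModerate.add hx hy
  one_mem' := isModerate_const 1
  zero_mem' := isModerate_const 0
  neg_mem' := by
    rintro x ⟨r, hr⟩
    exact ⟨r, by simpa using hr⟩

/-- The ideal of negligible nets. -/
def negligibleNets : Ideal moderateNets where
  carrier := {x | IsNegligible x.1}
  add_mem' := by
    intro x y hx hy k
    filter_upwards [hx (k + 1), hy (k + 1), small_lt (η := 1 / 2) (by norm_num)]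
      with ε h1 h2 h3
    have h0 : (0 : ℝ) < ε := ε.2.1
    have h4 : |(x + y).1 ε| ≤ |x.1 ε| + |y.1 ε| := abs_add_le _ _
    have h5 : (0 : ℝ) < (ε : ℝ) ^ k := pow_pos h0 k
    rw [pow_succ] at h1 h2
    nlinarith
  zero_mem' := by
    intro k
    filter_upwards with ε
    simpa using pow_pos ε.2.1 k
  smul_mem' := by
    rintro ⟨c, r, hr⟩ x hx k
    obtain ⟨m, hm⟩ := exists_nat_ge ((k : ℝ) - r)
    filter_upwards [hr, hx m] with ε h1 h2
    have h0 : (0 : ℝ) < ε := ε.2.1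
    have h3 : |c ε * x.1 ε| < (ε : ℝ) ^ r * (ε : ℝ) ^ m := by
      rw [abs_mul]
      exact mul_lt_mul'' h1 h2 (abs_nonneg _) (abs_nonneg _)
    refine lt_of_lt_of_le h3 ?_
    rw [← Real.rpow_natCast, ← Real.rpow_natCast, ← Real.rpow_add h0]
    exact Real.rpow_le_rpow_of_exponent_ge h0 ε.2.2 (by linarith)

/-- The ring `ℝ̄` of (Colombeau) generalized real numbers. -/
def GenReal : Type := moderateNets ⧸ negligibleNets

instance : CommRing GenReal := inferInstanceAs (CommRing (moderateNets ⧸ negligibleNets))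

/-- The class in `ℝ̄` of a moderate net. -/
def GenReal.mk (x : moderateNets) : GenReal := Ideal.Quotient.mk negligibleNets x

/-- The free `ℝ̄`-module `ℝ̄ⁿ` of generalized points. -/
abbrev GenVec (n : ℕ) : Type := Fin n → GenReal

/-- Nets of points of `ℝⁿ`. -/
abbrev Net (n : ℕ) : Type := Idx → EuclideanSpace ℝ (Fin n)

/-- The net `p` is moderate and represents the generalized point `x`, i.e. `x = [(p_ε)]`. -/
def IsRep {n : ℕ} (p : Net n) (x : GenVec n) : Prop :=
  ∀ i, ∃ h : (fun ε => p ε i) ∈ moderateNets, x i = GenReal.mk ⟨fun ε => p ε i, h⟩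

/-! ## The sharp norm and the sharp topology -/

/-- The sharp norm `‖x‖ = e ^ (-V x)`, with `V x` the supremum of the real `r` such that
`|p_ε| < ε ^ r` for small `ε`, where `p` represents `x`. It is written as the infimum of the
numbers `e ^ (-r)`, which is `0` when `V x = ∞`. -/
def sharpNorm {n : ℕ} (x : GenVec n) : ℝ :=
  sInf {s : ℝ | ∃ (r : ℝ) (p : Net n), IsRep p x ∧
    (∀ᶠ ε : Idx in small, ‖p ε‖ < (ε : ℝ) ^ r) ∧ s = Real.exp (-r)}

/-- The sharp topology of `ℝ̄ⁿ`, the topology of the metric `‖y - x‖`. -/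
instance sharpTopology (n : ℕ) : TopologicalSpace (GenVec n) where
  IsOpen S := ∀ x ∈ S, ∃ δ > 0, ∀ y, sharpNorm (y - x) < δ → y ∈ S
  isOpen_univ := fun _ _ => ⟨1, one_pos, fun _ _ => trivial⟩
  isOpen_inter := by
    rintro S T hS hT x ⟨hxS, hxT⟩
    obtain ⟨a, ha, h1⟩ := hS x hxS
    obtain ⟨b, hb, h2⟩ := hT x hxT
    exact ⟨min a b, lt_min ha hb, fun y hy =>
      ⟨h1 y (lt_of_lt_of_le hy (min_le_left _ _)), h2 y (lt_of_lt_of_le hy (min_le_right _ _))⟩⟩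
  isOpen_sUnion := by
    rintro F hF x ⟨S, hS, hx⟩
    obtain ⟨a, ha, h⟩ := hF S hS x hx
    exact ⟨a, ha, fun y hy => ⟨S, hS, h y hy⟩⟩

/-! ## Generalized points of a set, and strongly internal sets -/

/-- `X̃_c`: the generalized points with a representative in a compact subset of `X`. -/
def compactPoints {n : ℕ} (X : Set (EuclideanSpace ℝ (Fin n))) : Set (GenVec n) :=
  {x | ∃ K : Set (EuclideanSpace ℝ (Fin n)), IsCompact K ∧ K ⊆ X ∧
    ∃ p : Net n, IsRep p x ∧ ∀ᶠ ε in small, p ε ∈ K}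

/-- The strongly internal set `⟨B_ε⟩`, relative to the ambient set `X`, of a net of subsets
`B_ε ⊆ X`: the points of `X̃_c` each of whose representatives in `X` satisfies `p_ε ∈ B_ε` for
small `ε`. -/
def stronglyInternal {n : ℕ} (X : Set (EuclideanSpace ℝ (Fin n)))
    (B : Idx → Set (EuclideanSpace ℝ (Fin n))) : Set (GenVec n) :=
  {x | x ∈ compactPoints X ∧ ∀ p : Net n, IsRep p x → (∀ᶠ ε in small, p ε ∈ X) →
    ∀ᶠ ε in small, p ε ∈ B ε}

/-! ## Generalized differential calculus -/

/-- `f` is differentiable at `x`, relative to `D`, with `ℝ̄`-linear differential `L`: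
`‖f y - f x - L (y - x)‖ = o(‖y - x‖)` as `y → x` in `D`. -/
def HasGenDerivAt {n m : ℕ} (D : Set (GenVec n)) (f : GenVec n → GenVec m)
    (L : GenVec n →ₗ[GenReal] GenVec m) (x : GenVec n) : Prop :=
  ∀ δ > 0, ∃ ρ > 0, ∀ y ∈ D, sharpNorm (y - x) < ρ →
    sharpNorm (f y - f x - L (y - x)) ≤ δ * sharpNorm (y - x)

/-- `f` is of class `C^k` on `D`: it is continuous if `k = 0`; for `k + 1`, it is differentiable
at every point of `D` and its partial derivatives are of class `C^k`. -/
def GenContDiffOn {n m : ℕ} : ℕ → (GenVec n → GenVec m) → Set (GenVec n) → Prop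
  | 0, f, D => ContinuousOn f D
  | k + 1, f, D => ∃ f' : GenVec n → (GenVec n →ₗ[GenReal] GenVec m),
      (∀ x ∈ D, HasGenDerivAt D f (f' x) x) ∧
      ∀ j : Fin n, GenContDiffOn k (fun x => f' x (Pi.single j 1)) D

/-- `f` is a `C^∞` diffeomorphism of the open set `D` onto the open set `D'`. -/
def IsGenDiffeo {n : ℕ} (f : GenVec n → GenVec n) (D D' : Set (GenVec n)) : Prop :=
  IsOpen D ∧ IsOpen D' ∧ Set.BijOn f D D' ∧ (∀ k, GenContDiffOn k f D) ∧
    ∀ k, GenContDiffOn k (Function.invFunOn f D) D'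

/-! ## Submanifolds and their generalized charts -/

/-- An atlas `(U_α, φ_α)`, `α ∈ Λ`, exhibiting `M` as a `C^∞` submanifold of `ℝᴺ` of dimension
`n`, all of whose charts have the image `Ω₀ = B_r(0)`: each `U_α = (chart α).source` is relatively
open in `M`, `φ_α = chart α` is a homeomorphism of `U_α` onto `Ω₀`, and its inverse is a smooth
immersion of `Ω₀` into `ℝᴺ`. -/
structure SubmanifoldAtlas {N : ℕ} (M : Set (EuclideanSpace ℝ (Fin N))) (n : ℕ) (r : ℝ)
    (Λ : Type*) where
  chart : Λ → PartialEquiv (EuclideanSpace ℝ (Fin N)) (EuclideanSpace ℝ (Fin n))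
  target_eq : ∀ α, (chart α).target = Metric.ball 0 r
  source_open : ∀ α, ∃ O, IsOpen O ∧ (chart α).source = M ∩ O
  cover : M = ⋃ α, (chart α).source
  continuousOn_chart : ∀ α, ContinuousOn (chart α) (chart α).source
  smooth_symm : ∀ α, ContDiffOn ℝ ∞ (chart α).symm (Metric.ball 0 r)
  immersion : ∀ α, ∀ x ∈ Metric.ball 0 r, Function.Injective (fderiv ℝ (chart α).symm x)

namespace SubmanifoldAtlas

variable {N n : ℕ} {M : Set (EuclideanSpace ℝ (Fin N))} {r : ℝ} {Λ : Type*}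
  (A : SubmanifoldAtlas M n r Λ)

/-- Each chart and its inverse are Lipschitz. -/
def IsBiLipschitz : Prop :=
  ∀ α, (∃ C, LipschitzOnWith C (A.chart α) (A.chart α).source) ∧
    ∃ C, LipschitzOnWith C (A.chart α).symm (Metric.ball 0 r)

/-- The chart domain `U_α` is relatively compact in `M`. -/
def IsRelCompact (α : Λ) : Prop :=
  ∃ K : Set (EuclideanSpace ℝ (Fin N)), IsCompact K ∧ K ⊆ M ∧ (A.chart α).source ⊆ K

/-- The derivatives of all orders of `φ_α⁻¹` on `Ω₀ = B_r(0)` grow at most polynomially in the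
inverse of the distance to the boundary. -/
def HasModerateGrowth (α : Λ) : Prop :=
  ∀ k : ℕ, ∃ (C : ℝ) (m : ℕ), ∀ x ∈ Metric.ball 0 r,
    ‖iteratedFDeriv ℝ k (A.chart α).symm x‖ ≤ C * ((r - ‖x‖)⁻¹) ^ m

/-- `U_λ = ⟨U_{λ(ε)}⟩`, strongly internal relative to `M`. -/
def genDomain (l : Idx → Λ) : Set (GenVec N) :=
  stronglyInternal M (fun ε => (A.chart (l ε)).source)

open Classical in
/-- `φ_λ [(p_ε)] = [(φ_{λ(ε)}(p_ε))]`, where `p_ε ∈ U_{λ(ε)}` for small `ε`. -/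
def genChart (l : Idx → Λ) (x : GenVec N) : GenVec n :=
  if h : ∃ y : GenVec n, ∃ p : Net N, IsRep p x ∧
      (∀ᶠ ε in small, p ε ∈ (A.chart (l ε)).source) ∧ IsRep (fun ε => A.chart (l ε) (p ε)) y
  then h.choose else 0

/-- The change of charts `φ_{λ₂} ∘ φ_{λ₁}⁻¹`. -/
def transition (l₁ l₂ : Idx → Λ) (x : GenVec n) : GenVec n :=
  A.genChart l₂ (Function.invFunOn (A.genChart l₁) (A.genDomain l₁) x)

/-- `τ` is a topology of `M̃_c` for which all charts `(U_λ, φ_λ)`, with `λ` of finite range, are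
homeomorphisms of open subsets of `M̃_c` onto open subsets of `ℝ̄ⁿ`. -/
def IsChartTopology (τ : TopologicalSpace (compactPoints M)) : Prop :=
  ∀ l : Idx → Λ, (Set.range l).Finite →
    Set.InjOn (A.genChart l) (A.genDomain l) ∧
    IsOpen[τ] (Subtype.val ⁻¹' A.genDomain l) ∧
    ∀ V ⊆ A.genDomain l, IsOpen[τ] (Subtype.val ⁻¹' V) ↔ IsOpen (A.genChart l '' V)

end SubmanifoldAtlas

end

/-! ## Small parameters -/

/-! Two facts about the sharp norm drive everything. Multiplying representatives by a constant does
not change orders of magnitude in `ε`, so a Lipschitz bound with a constant uniform in `ε` costs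
nothing (`sharpNorm_le_of_norm_le`); and smallness of the norm means polynomial closeness of
representatives. Since `λ` has finite range, the Lipschitz constants of the charts `φ_{λ(ε)}` and of
their inverses are uniform in `ε`, and `φ_λ` is isometric.

The strongly internal condition becomes quantitative through a diagonal argument: `x` lies in
`⟨B_ε⟩` exactly when some representative in `X` has, for some `m`, its whole `ε ^ m`-neighbourhood
in `X` contained in `B_ε` for small `ε` (`exists_pow_of_mem_stronglyInternal`,
`mem_stronglyInternal_of_pow`). Openness of the domains follows. That `φ_λ` respects strong
internality reduces to comparing, up to constants, distances to the boundary of `U_α` in `M` and of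
`Ω₀` (`ball_subset_of_dist`, `source_of_ball_subset`). Pulling back nearby nets shows that images of
charts are open; relative compactness is only needed to keep arbitrary pulled back nets in a compact
set, for surjectivity. The covering comes from a Lebesgue number, and the topology is then
determined by the isometric charts.

For changes of charts, a net of smooth maps whose derivatives are moderate along all nets of an open
set represents a generalized smooth map, by Taylor's formula (`genContDiffOn_of_isRep`). No growth
of the derivatives of `φ_α` itself is assumed: with `g = φ_{λ₂} ∘ φ_{λ₁}⁻¹`, differentiating
`φ_{λ₂}⁻¹ ∘ g = φ_{λ₁}⁻¹` gives a linear equation for `Dg` whose operator is bounded below because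
`φ_{λ₂}` is Lipschitz, and moderateness climbs one order at a time (`NetModerate.of_apply_eq`). -/

instance small_neBot : small.NeBot := by
  refine Filter.comap_neBot fun t ht => ?_
  obtain ⟨δ, hδ, h⟩ := Metric.mem_nhds_iff.1 ht
  refine ⟨⟨min (δ / 2) 1, by positivity, min_le_right _ _⟩, h ?_⟩
  have h0 : 0 < min (δ / 2) 1 := by positivity
  rw [Metric.mem_ball, Real.dist_eq, sub_zero, abs_of_pos h0]
  exact lt_of_le_of_lt (min_le_left _ _) (by linarith)

theorem eventually_small_iff {P : Idx → Prop} :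
    (∀ᶠ ε in small, P ε) ↔ ∃ η > 0, ∀ ε : Idx, (ε : ℝ) < η → P ε := by
  constructor
  · intro h
    obtain ⟨t, ht, hs⟩ := Filter.mem_comap.1 h
    obtain ⟨δ, hδ, h⟩ := Metric.mem_nhds_iff.1 ht
    refine ⟨δ, hδ, fun ε hε => hs (h ?_)⟩
    rwa [Metric.mem_ball, Real.dist_eq, sub_zero, abs_of_pos ε.2.1]
  · rintro ⟨η, hη, h⟩
    exact (small_lt hη).mono h

theorem Idx.rpow_anti (ε : Idx) {r s : ℝ} (h : r ≤ s) : (ε : ℝ) ^ s ≤ (ε : ℝ) ^ r :=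
  Real.rpow_le_rpow_of_exponent_ge ε.2.1 ε.2.2 h

theorem Idx.rpow_pos (ε : Idx) (r : ℝ) : 0 < (ε : ℝ) ^ r := Real.rpow_pos_of_pos ε.2.1 r

theorem eventually_rpow_lt {s c : ℝ} (hs : 0 < s) (hc : 0 < c) :
    ∀ᶠ ε : Idx in small, (ε : ℝ) ^ s < c := by
  have h : 0 < c ^ s⁻¹ := Real.rpow_pos_of_pos hc _
  filter_upwards [small_lt h] with ε hε
  calc (ε : ℝ) ^ s < (c ^ s⁻¹) ^ s := Real.rpow_lt_rpow ε.2.1.le hε hs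
    _ = c := by rw [← Real.rpow_mul hc.le, inv_mul_cancel₀ hs.ne', Real.rpow_one]

theorem eventually_const_mul_rpow_lt (C : ℝ) {r s : ℝ} (h : r < s) :
    ∀ᶠ ε : Idx in small, C * (ε : ℝ) ^ s < (ε : ℝ) ^ r := by
  have hc : 0 < 1 / (|C| + 1) := by positivity
  filter_upwards [eventually_rpow_lt (sub_pos.2 h) hc] with ε h1
  have h0 := ε.rpow_pos r
  have e : (ε : ℝ) ^ s = (ε : ℝ) ^ (s - r) * (ε : ℝ) ^ r := by
    rw [← Real.rpow_add ε.2.1]; congr 1; ring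
  have h2 := ε.rpow_pos (s - r)
  rw [lt_div_iff₀ (by positivity)] at h1
  have h3 : C * (ε : ℝ) ^ (s - r) < 1 := by nlinarith [le_abs_self C]
  rw [e, ← mul_assoc]
  nlinarith

/-! ## Moderate and negligible nets of real numbers -/

theorem IsModerate.mono {x y : Idx → ℝ} (hy : IsModerate y) (h : ∀ᶠ ε in small, |x ε| ≤ |y ε|) :
    IsModerate x := by
  obtain ⟨r, hr⟩ := hy
  exact ⟨r, by filter_upwards [h, hr] with ε h1 h2 using h1.trans_lt h2⟩

theorem IsNegligible.mono {x y : Idx → ℝ} (hy : IsNegligible y)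
    (h : ∀ᶠ ε in small, |x ε| ≤ |y ε|) : IsNegligible x := fun k => by
  filter_upwards [h, hy k] with ε h1 h2 using h1.trans_lt h2

theorem IsNegligible.isModerate {x : Idx → ℝ} (hx : IsNegligible x) : IsModerate x :=
  ⟨0, by simpa using hx 0⟩

theorem IsNegligible.add {x y : Idx → ℝ} (hx : IsNegligible x) (hy : IsNegligible y) :
    IsNegligible (x + y) :=
  negligibleNets.add_mem (a := ⟨x, hx.isModerate⟩) (b := ⟨y, hy.isModerate⟩) hx hy

theorem IsModerate.mul_isNegligible {x y : Idx → ℝ} (hx : IsModerate x) (hy : IsNegligible y) :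
    IsNegligible (x * y) :=
  negligibleNets.mul_mem_left (⟨x, hx⟩ : moderateNets) (b := ⟨y, hy.isModerate⟩) hy

theorem isNegligible_zero : IsNegligible (fun _ => 0) := negligibleNets.zero_mem

theorem isModerate_sum {ι : Type*} (s : Finset ι) {x : ι → Idx → ℝ}
    (h : ∀ i ∈ s, IsModerate (x i)) : IsModerate (∑ i ∈ s, x i) :=
  moderateNets.sum_mem h

theorem isNegligible_sum {ι : Type*} (s : Finset ι) {x : ι → Idx → ℝ}
    (h : ∀ i ∈ s, IsNegligible (x i)) : IsNegligible (∑ i ∈ s, x i) := by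
  classical
  induction s using Finset.induction_on with
  | empty => exact isNegligible_zero
  | insert a s ha ih =>
    rw [Finset.sum_insert ha]
    exact (h a (by simp)).add (ih fun i hi => h i (by simp [hi]))

theorem IsModerate.exists_nat {x : Idx → ℝ} (hx : IsModerate x) :
    ∃ m : ℕ, ∀ᶠ ε : Idx in small, |x ε| < (ε : ℝ) ^ (-(m : ℝ)) := by
  obtain ⟨r, hr⟩ := hx
  obtain ⟨m, hm⟩ := exists_nat_ge (-r)
  refine ⟨m, hr.mono fun ε h => h.trans_le (ε.rpow_anti (by linarith))⟩

theorem isModerate_inv_pow (m : ℕ) : IsModerate (fun ε => ((ε : ℝ) ^ m)⁻¹) := by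
  refine ⟨-m - 1, ?_⟩
  filter_upwards [eventually_const_mul_rpow_lt 1 (show (-m - 1 : ℝ) < -m by linarith)] with ε h
  rw [Real.rpow_neg ε.2.1.le, Real.rpow_natCast, one_mul] at h
  have h0 : (0 : ℝ) < ε := ε.2.1
  rwa [abs_of_pos (by positivity)]

/-! ## Representatives of generalized points -/

theorem abs_apply_le_norm {n : ℕ} (v : EuclideanSpace ℝ (Fin n)) (i : Fin n) : |v i| ≤ ‖v‖ :=
  PiLp.norm_apply_le v i

theorem norm_le_sum_abs {n : ℕ} (v : EuclideanSpace ℝ (Fin n)) : ‖v‖ ≤ ∑ i, |v i| := by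
  rw [EuclideanSpace.norm_eq]
  refine Real.sqrt_le_iff.2 ⟨Finset.sum_nonneg fun i _ => abs_nonneg _, ?_⟩
  exact Finset.sum_sq_le_sq_sum_of_nonneg fun i _ => abs_nonneg _

theorem isModerate_norm_iff {n : ℕ} {p : Net n} :
    IsModerate (fun ε => ‖p ε‖) ↔ ∀ i, IsModerate (fun ε => p ε i) := by
  constructor
  · intro h i
    refine h.mono (.of_forall fun ε => ?_)
    rw [abs_norm]
    exact abs_apply_le_norm _ _
  · intro h
    have := isModerate_sum Finset.univ (x := fun i ε => |p ε i|) fun i _ =>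
      (h i).mono (.of_forall fun ε => by simp)
    refine this.mono (.of_forall fun ε => ?_)
    rw [abs_norm, Finset.sum_apply]
    exact (norm_le_sum_abs _).trans (le_abs_self _)

theorem isNegligible_norm_iff {n : ℕ} {p : Net n} :
    IsNegligible (fun ε => ‖p ε‖) ↔ ∀ i, IsNegligible (fun ε => p ε i) := by
  constructor
  · intro h i
    refine h.mono (.of_forall fun ε => ?_)
    rw [abs_norm]
    exact abs_apply_le_norm _ _
  · intro h
    have := isNegligible_sum Finset.univ (x := fun i ε => |p ε i|) fun i _ =>
      (h i).mono (.of_forall fun ε => by simp)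
    refine this.mono (.of_forall fun ε => ?_)
    rw [abs_norm, Finset.sum_apply]
    exact (norm_le_sum_abs _).trans (le_abs_self _)

theorem IsRep.isModerate {n : ℕ} {p : Net n} {x : GenVec n} (h : IsRep p x) :
    IsModerate (fun ε => ‖p ε‖) :=
  isModerate_norm_iff.2 fun i => (h i).1

theorem exists_isRep_of_isModerate {n : ℕ} {p : Net n} (h : IsModerate (fun ε => ‖p ε‖)) :
    ∃ x, IsRep p x :=
  ⟨fun i => GenReal.mk ⟨fun ε => p ε i, isModerate_norm_iff.1 h i⟩, fun i =>
    ⟨isModerate_norm_iff.1 h i, rfl⟩⟩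

theorem exists_isRep {n : ℕ} (x : GenVec n) : ∃ p : Net n, IsRep p x := by
  have h : ∀ i, ∃ y : moderateNets, GenReal.mk y = x i := fun i =>
    Ideal.Quotient.mk_surjective (x i)
  choose y hy using h
  exact ⟨fun ε => WithLp.toLp 2 fun i => (y i).1 ε, fun i => ⟨(y i).2, (hy i).symm⟩⟩

theorem IsRep.unique {n : ℕ} {p : Net n} {x y : GenVec n} (hx : IsRep p x) (hy : IsRep p y) :
    x = y := by
  ext i
  obtain ⟨_, h⟩ := hx i
  obtain ⟨_, h'⟩ := hy i
  rw [h, h']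

theorem IsRep.add {n : ℕ} {p q : Net n} {x y : GenVec n} (hx : IsRep p x) (hy : IsRep q y) :
    IsRep (fun ε => p ε + q ε) (x + y) := fun i => by
  obtain ⟨h1, e1⟩ := hx i
  obtain ⟨h2, e2⟩ := hy i
  refine ⟨moderateNets.add_mem h1 h2, ?_⟩
  rw [Pi.add_apply, e1, e2]
  exact (map_add (Ideal.Quotient.mk negligibleNets) _ _).symm

theorem IsRep.sub {n : ℕ} {p q : Net n} {x y : GenVec n} (hx : IsRep p x) (hy : IsRep q y) :
    IsRep (fun ε => p ε - q ε) (x - y) := fun i => by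
  obtain ⟨h1, e1⟩ := hx i
  obtain ⟨h2, e2⟩ := hy i
  refine ⟨moderateNets.sub_mem h1 h2, ?_⟩
  rw [Pi.sub_apply, e1, e2]
  exact (map_sub (Ideal.Quotient.mk negligibleNets) _ _).symm

theorem isRep_zero_iff {n : ℕ} {p : Net n} :
    IsRep p 0 ↔ IsNegligible (fun ε => ‖p ε‖) := by
  rw [isNegligible_norm_iff]
  refine forall_congr' fun i => ⟨?_, fun h => ⟨h.isModerate, ?_⟩⟩
  · rintro ⟨h, e⟩
    have := Ideal.Quotient.eq_zero_iff_mem.1 e.symm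
    exact this
  · exact (Ideal.Quotient.eq_zero_iff_mem.2 h).symm

theorem IsRep.isNegligible_sub {n : ℕ} {p q : Net n} {x : GenVec n} (hp : IsRep p x)
    (hq : IsRep q x) : IsNegligible (fun ε => ‖p ε - q ε‖) := by
  rw [← isRep_zero_iff, ← sub_self x]
  exact hp.sub hq

theorem IsRep.of_isNegligible_sub {n : ℕ} {p q : Net n} {x : GenVec n} (hp : IsRep p x)
    (h : IsNegligible (fun ε => ‖q ε - p ε‖)) : IsRep q x := by
  simpa using (isRep_zero_iff.2 h).add hp

theorem IsRep.congr {n : ℕ} {p q : Net n} {x : GenVec n} (hp : IsRep p x)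
    (h : ∀ᶠ ε in small, q ε = p ε) : IsRep q x :=
  hp.of_isNegligible_sub (isNegligible_zero.mono (h.mono fun ε e => by simp [e]))

theorem IsNegligible.eventually_lt_rpow {x : Idx → ℝ} (h : IsNegligible x) (r : ℝ) :
    ∀ᶠ ε : Idx in small, |x ε| < (ε : ℝ) ^ r := by
  obtain ⟨k, hk⟩ := exists_nat_ge r
  filter_upwards [h k] with ε h
  rw [← Real.rpow_natCast] at h
  exact h.trans_le (ε.rpow_anti hk)

/-! ## The sharp norm -/

theorem sharpNorm_nonneg {n : ℕ} (x : GenVec n) : 0 ≤ sharpNorm x :=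
  Real.sInf_nonneg (by rintro s ⟨r, p, -, -, rfl⟩; exact (Real.exp_pos _).le)

theorem sharpNorm_le {n : ℕ} {p : Net n} {x : GenVec n} {r : ℝ} (hp : IsRep p x)
    (h : ∀ᶠ ε : Idx in small, ‖p ε‖ < (ε : ℝ) ^ r) : sharpNorm x ≤ Real.exp (-r) :=
  csInf_le ⟨0, by rintro s ⟨r, p, -, -, rfl⟩; exact (Real.exp_pos _).le⟩ ⟨r, p, hp, h, rfl⟩

/-- The infimum runs over all representatives, but two of them differ by a negligible net, so a
strict bound passes to any given one; the gap `r < s` absorbs the factor 2. -/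
theorem IsRep.eventually_norm_lt {n : ℕ} {p : Net n} {x : GenVec n} {r : ℝ} (hp : IsRep p x)
    (h : sharpNorm x < Real.exp (-r)) : ∀ᶠ ε : Idx in small, ‖p ε‖ < (ε : ℝ) ^ r := by
  obtain ⟨m, hm⟩ := hp.isModerate
  simp only [abs_norm] at hm
  obtain ⟨_, ⟨s, q, hq, h1, rfl⟩, h2⟩ := exists_lt_of_csInf_lt
    (by exact ⟨_, m, p, hp, hm, rfl⟩) h
  have hrs : r < s := by simpa using h2
  filter_upwards [h1, (hp.isNegligible_sub hq).eventually_lt_rpow s,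
    eventually_const_mul_rpow_lt 2 hrs] with ε e1 e2 e3
  rw [abs_norm] at e2
  have := norm_add_le (p ε - q ε) (q ε)
  rw [sub_add_cancel] at this
  linarith

theorem sharpNorm_le_mul {n m : ℕ} {p : Net n} {x : GenVec n} {q : Net m} {y : GenVec m}
    {c : Idx → ℝ} {s : ℝ} (hp : IsRep p x) (hq : IsRep q y)
    (hc : ∀ t < s, ∀ᶠ ε : Idx in small, c ε ≤ (ε : ℝ) ^ t)
    (h : ∀ᶠ ε in small, ‖p ε‖ ≤ c ε * ‖q ε‖) :
    sharpNorm x ≤ Real.exp (-s) * sharpNorm y := by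
  refine le_of_forall_gt fun T hT => ?_
  obtain ⟨T', h1, h2⟩ := exists_between hT
  refine lt_of_le_of_lt ?_ h2
  have hT' : 0 < T' := lt_of_le_of_lt (mul_nonneg (Real.exp_pos _).le (sharpNorm_nonneg _)) h1
  have h3 : sharpNorm y < Real.exp (s + Real.log T') := by
    rw [Real.exp_add, Real.exp_log hT']
    rw [Real.exp_neg, inv_mul_lt_iff₀ (Real.exp_pos _)] at h1
    exact h1
  -- With `u` slightly above the norm of `y`, the exponent `log u - log T'` stays strictly below
  -- `s`, where the bound on `c` is available.
  obtain ⟨u, h4, h5⟩ := exists_between h3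
  have hu : 0 < u := lt_of_le_of_lt (sharpNorm_nonneg _) h4
  have h6 : Real.log u < s + Real.log T' := by rwa [Real.log_lt_iff_lt_exp hu]
  have h7 : ∀ᶠ ε : Idx in small, ‖q ε‖ < (ε : ℝ) ^ (-Real.log u) :=
    hq.eventually_norm_lt (by rwa [neg_neg, Real.exp_log hu])
  have h8 : sharpNorm x ≤ Real.exp (-(-Real.log T')) := by
    refine sharpNorm_le hp ?_
    filter_upwards [h, h7, hc (Real.log u - Real.log T') (by linarith)] with ε e1 e2 e3
    calc ‖p ε‖ ≤ (ε : ℝ) ^ (Real.log u - Real.log T') * ‖q ε‖ :=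
          e1.trans (mul_le_mul_of_nonneg_right e3 (norm_nonneg _))
      _ < (ε : ℝ) ^ (Real.log u - Real.log T') * (ε : ℝ) ^ (-Real.log u) :=
          mul_lt_mul_of_pos_left e2 (ε.rpow_pos _)
      _ = (ε : ℝ) ^ (-Real.log T') := by rw [← Real.rpow_add ε.2.1]; congr 1; ring
  rwa [neg_neg, Real.exp_log hT'] at h8

/-- A constant is eventually below `ε ^ t` for every `t < 0`, so it acts as a factor of order `s =
0`. -/
theorem sharpNorm_le_of_norm_le {n m : ℕ} {p : Net n} {x : GenVec n} {q : Net m} {y : GenVec m}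
    (C : ℝ) (hp : IsRep p x) (hq : IsRep q y) (h : ∀ᶠ ε in small, ‖p ε‖ ≤ C * ‖q ε‖) :
    sharpNorm x ≤ sharpNorm y := by
  have := sharpNorm_le_mul (s := 0) (c := fun _ => C) hp hq (fun t ht => by
    filter_upwards [eventually_const_mul_rpow_lt C ht] with ε h
    simpa using h.le) h
  simpa using this

theorem sharpNorm_zero {n : ℕ} : sharpNorm (0 : GenVec n) = 0 := by
  refine le_antisymm (le_of_forall_gt fun T hT => ?_) (sharpNorm_nonneg _)
  obtain ⟨u, h1, h2⟩ := exists_between hT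
  refine lt_of_le_of_lt ?_ h2
  have h := sharpNorm_le (p := fun _ => (0 : EuclideanSpace ℝ (Fin n))) (r := -Real.log u)
    (isRep_zero_iff.2 (by simpa using isNegligible_zero))
    (.of_forall fun ε => by simpa using ε.rpow_pos _)
  rwa [neg_neg, Real.exp_log h1] at h

theorem sharpNorm_eq_zero {n : ℕ} {x : GenVec n} (h : sharpNorm x = 0) : x = 0 := by
  obtain ⟨p, hp⟩ := exists_isRep x
  refine hp.unique (isRep_zero_iff.2 fun k => ?_)
  have := hp.eventually_norm_lt (r := k) (by rw [h]; exact Real.exp_pos _)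
  simpa using this

/-- The factor 2 from the triangle inequality is absorbed by an arbitrarily small loss in the
exponent, hence the ultrametric inequality. -/
theorem sharpNorm_add_le {n : ℕ} (x y : GenVec n) :
    sharpNorm (x + y) ≤ max (sharpNorm x) (sharpNorm y) := by
  refine le_of_forall_gt fun T hT => ?_
  obtain ⟨u, h1, h2⟩ := exists_between hT
  obtain ⟨v, h3, h4⟩ := exists_between h1
  refine lt_of_le_of_lt ?_ h2
  obtain ⟨h5, h6⟩ := max_lt_iff.1 h3
  have hv : 0 < v := lt_of_le_of_lt (sharpNorm_nonneg _) h5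
  have hu : 0 < u := hv.trans h4
  obtain ⟨p, hp⟩ := exists_isRep x
  obtain ⟨q, hq⟩ := exists_isRep y
  have e : Real.exp (- -Real.log v) = v := by rw [neg_neg, Real.exp_log hv]
  have h := sharpNorm_le (r := -Real.log u) (hp.add hq) (by
    filter_upwards [hp.eventually_norm_lt (r := -Real.log v) (by rwa [e]),
      hq.eventually_norm_lt (r := -Real.log v) (by rwa [e]),
      eventually_const_mul_rpow_lt 2 (neg_lt_neg (Real.log_lt_log hv h4))] with ε e1 e2 e3
    have := norm_add_le (p ε) (q ε)
    linarith)
  rwa [neg_neg, Real.exp_log hu] at h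

/-! ## The sharp topology -/

theorem isOpen_sharp_iff {n : ℕ} {S : Set (GenVec n)} :
    IsOpen S ↔ ∀ x ∈ S, ∃ δ > 0, ∀ y, sharpNorm (y - x) < δ → y ∈ S := Iff.rfl

theorem isOpen_sharpBall {n : ℕ} (x : GenVec n) (δ : ℝ) :
    IsOpen {y | sharpNorm (y - x) < δ} := by
  rw [isOpen_sharp_iff]
  intro y hy
  refine ⟨δ, lt_of_le_of_lt (sharpNorm_nonneg _) hy, fun z hz => ?_⟩
  have := sharpNorm_add_le (z - y) (y - x)
  rw [sub_add_sub_cancel] at this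
  exact this.trans_lt (max_lt hz hy)

theorem isOpen_preimage_val_iff {n : ℕ} {X V : Set (GenVec n)} :
    IsOpen (Subtype.val ⁻¹' V : Set X) ↔
      ∀ x ∈ V, x ∈ X → ∃ δ > 0, ∀ y ∈ X, sharpNorm (y - x) < δ → y ∈ V := by
  constructor
  · rintro h x hx hX
    obtain ⟨T, hT, e⟩ := isOpen_induced_iff.1 h
    have hxT : (⟨x, hX⟩ : X) ∈ (Subtype.val ⁻¹' T : Set X) := by rw [e]; exact hx
    obtain ⟨δ, hδ, h⟩ := isOpen_sharp_iff.1 hT x hxT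
    refine ⟨δ, hδ, fun y hy hyx => ?_⟩
    have : (⟨y, hy⟩ : X) ∈ (Subtype.val ⁻¹' T : Set X) := h y hyx
    rw [e] at this
    exact this
  · intro h
    rw [isOpen_iff_forall_mem_open]
    rintro ⟨x, hX⟩ hx
    obtain ⟨δ, hδ, h⟩ := h x hx hX
    refine ⟨Subtype.val ⁻¹' {y | sharpNorm (y - x) < δ}, fun y hy => h y y.2 hy,
      (isOpen_sharpBall x δ).preimage continuous_subtype_val, ?_⟩
    simpa [sharpNorm_zero] using hδ

theorem continuousOn_of_sharpNorm {n m : ℕ} {f : GenVec n → GenVec m} {D : Set (GenVec n)}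
    (h : ∀ x ∈ D, ∀ δ > 0, ∃ ρ > 0, ∀ y ∈ D, sharpNorm (y - x) < ρ →
      sharpNorm (f y - f x) < δ) : ContinuousOn f D := by
  intro x hx
  refine tendsto_nhds.2 fun S hS hxS => ?_
  obtain ⟨δ, hδ, h1⟩ := isOpen_sharp_iff.1 hS _ hxS
  obtain ⟨ρ, hρ, h2⟩ := h x hx δ hδ
  have : {y | sharpNorm (y - x) < ρ} ∈ 𝓝 x :=
    (isOpen_sharpBall x ρ).mem_nhds (by simpa [sharpNorm_zero] using hρ)
  filter_upwards [mem_nhdsWithin_of_mem_nhds this, self_mem_nhdsWithin] with y hy hyD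
  exact h1 _ (h2 y hyD hy)

/-! ## Strongly internal sets -/

/-- Points that exist at every polynomial scale around a given net can be assembled into a net
negligibly close to it. -/
theorem exists_net_of_frequently {n : ℕ} (p : Net n)
    {Q : ℕ → Idx → EuclideanSpace ℝ (Fin n) → Prop}
    (h : ∀ m : ℕ, ∃ᶠ ε in small, ∃ z, ‖z - p ε‖ < (ε : ℝ) ^ m ∧ Q m ε z) :
    ∃ q : Net n, IsNegligible (fun ε => ‖q ε - p ε‖) ∧ (∀ ε, q ε = p ε ∨ ∃ m, Q m ε (q ε)) ∧
      ∀ K, ∃ᶠ ε in small, ∃ m ≥ K, Q m ε (q ε) := by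
  classical
  have h' : ∀ m : ℕ, ∃ ε : Idx, (ε : ℝ) < 1 / (m + 1) ∧
      ∃ z, ‖z - p ε‖ < (ε : ℝ) ^ m ∧ Q m ε z := fun m => by
    obtain ⟨ε, h1, h2⟩ :=
      ((h m).and_eventually (small_lt (η := 1 / (m + 1)) (by positivity))).exists
    exact ⟨ε, h2, h1⟩
  choose e he z hz hQ using h'
  -- The parameters `e m` may repeat, so one index is chosen for each value taken; elsewhere `q`
  -- agrees with `p`.
  let q : Net n := fun ε => if H : ∃ m, e m = ε then z H.choose else p ε
  have hq : ∀ m, ∃ k, e k = e m ∧ q (e m) = z k := fun m => by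
    have H : ∃ k, e k = e m := ⟨m, rfl⟩
    exact ⟨H.choose, H.choose_spec, by simp only [q, dif_pos H]⟩
  have hq' : ∀ ε, q ε = p ε ∨ ∃ m, e m = ε ∧ q ε = z m := fun ε => by
    by_cases H : ∃ m, e m = ε
    · exact .inr ⟨H.choose, H.choose_spec, by simp only [q, dif_pos H]⟩
    · exact .inl (by simp only [q, dif_neg H])
  -- Each `e m` is positive, so below the first `K` of them only indices at least `K` occur.
  have hK : ∀ K, ∀ᶠ ε : Idx in small, ∀ m, e m = ε → K ≤ m := fun K => by
    have : ∀ᶠ ε : Idx in small, ∀ m ∈ Finset.range K, e m ≠ ε := by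
      rw [Filter.eventually_all_finset]
      exact fun m _ => (small_lt (e m).2.1).mono fun ε h1 h2 => by
        rw [h2] at h1
        exact lt_irrefl _ h1
    filter_upwards [this] with ε h1 m h2
    by_contra hlt
    exact h1 m (by simpa using hlt) h2
  refine ⟨q, fun K => ?_, fun ε => ?_, fun K => ?_⟩
  · filter_upwards [hK K] with ε h1
    rw [abs_norm]
    rcases hq' ε with h2 | ⟨m, h2, h3⟩
    · rw [h2, sub_self, norm_zero]
      exact pow_pos ε.2.1 K
    · have hKm := h1 m h2
      rw [h3, ← h2]
      exact (hz m).trans_le (pow_le_pow_of_le_one (e m).2.1.le (e m).2.2 hKm)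
  · rcases hq' ε with h2 | ⟨m, h2, h3⟩
    · exact .inl h2
    · exact .inr ⟨m, by rw [h3, ← h2]; exact hQ m⟩
  · have h1 : ∃ᶠ ε in small, ∃ k, e k = ε ∧ q ε = z k := by
      intro hn
      obtain ⟨η, hη, hn⟩ := eventually_small_iff.1 hn
      obtain ⟨m, hm⟩ := exists_nat_one_div_lt hη
      exact hn (e m) ((he m).trans hm) (hq m)
    refine (h1.and_eventually (hK K)).mono ?_
    rintro ε ⟨⟨k, rfl, h2⟩, h3⟩
    exact ⟨k, h3 k rfl, by rw [h2]; exact hQ k⟩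

theorem eventually_two_mul_pow_lt (m : ℕ) :
    ∀ᶠ ε : Idx in small, 2 * (ε : ℝ) ^ (m + 1) < (ε : ℝ) ^ m := by
  filter_upwards [small_lt (η := 1 / 2) (by norm_num)] with ε h
  have := pow_pos ε.2.1 m
  rw [pow_succ]
  nlinarith

theorem IsRep.eventually_norm_sub_lt {n : ℕ} {p q : Net n} {x : GenVec n} (hp : IsRep p x)
    (hq : IsRep q x) (m : ℕ) : ∀ᶠ ε : Idx in small, ‖p ε - q ε‖ < (ε : ℝ) ^ m := by
  simpa using hp.isNegligible_sub hq m

theorem exists_isRep_of_mem_compactPoints {n : ℕ} {X : Set (EuclideanSpace ℝ (Fin n))}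
    {x : GenVec n} (hx : x ∈ compactPoints X) :
    ∃ p : Net n, IsRep p x ∧ ∀ᶠ ε in small, p ε ∈ X := by
  obtain ⟨K, -, hK, p, hp, h⟩ := hx
  exact ⟨p, hp, h.mono fun ε h => hK h⟩

/-- A strongly internal point stays at a polynomial distance from the complement of the sets. -/
theorem exists_pow_of_mem_stronglyInternal {n : ℕ} {X : Set (EuclideanSpace ℝ (Fin n))}
    {B : Idx → Set (EuclideanSpace ℝ (Fin n))} {x : GenVec n} (hx : x ∈ stronglyInternal X B)
    {p : Net n} (hp : IsRep p x) (hpX : ∀ᶠ ε in small, p ε ∈ X) :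
    ∃ m : ℕ, ∀ᶠ ε : Idx in small, ∀ z ∈ X, ‖z - p ε‖ < (ε : ℝ) ^ m → z ∈ B ε := by
  by_contra hc
  push Not at hc
  -- If every polynomial scale fails, the bad points assemble into another representative with
  -- values in `X` that leaves `B ε` for arbitrarily small `ε`.
  obtain ⟨q, h1, h2, h3⟩ := exists_net_of_frequently p (Q := fun _ ε z => z ∈ X ∧ z ∉ B ε) (by
    intro m
    refine (hc m).mono ?_
    rintro ε ⟨z, hz, hz1, hz2⟩
    exact ⟨z, hz1, hz, hz2⟩)
  have hq := hx.2 q (hp.of_isNegligible_sub h1) (hpX.mono fun ε h => by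
    rcases h2 ε with e | e
    · rwa [e]
    · exact e.choose_spec.1)
  obtain ⟨ε, ⟨_, _, h4⟩, h5⟩ := ((h3 0).and_eventually hq).exists
  exact h4.2 h5

theorem mem_stronglyInternal_of_pow {n : ℕ} {X : Set (EuclideanSpace ℝ (Fin n))}
    {B : Idx → Set (EuclideanSpace ℝ (Fin n))} {x : GenVec n} (hx : x ∈ compactPoints X)
    {p : Net n} (hp : IsRep p x) {m : ℕ}
    (h : ∀ᶠ ε : Idx in small, ∀ z ∈ X, ‖z - p ε‖ < (ε : ℝ) ^ m → z ∈ B ε) :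
    x ∈ stronglyInternal X B := by
  refine ⟨hx, fun q hq hqX => ?_⟩
  filter_upwards [h, hqX, hq.eventually_norm_sub_lt hp m] with ε h1 h2 h3 using h1 _ h2 h3

theorem exp_neg_nat_pos (m : ℕ) : 0 < Real.exp (-(m : ℝ)) := Real.exp_pos _

theorem eventually_norm_sub_lt_of_sharpNorm {n : ℕ} {p q : Net n} {x y : GenVec n}
    (hp : IsRep p x) (hq : IsRep q y) {m : ℕ} (h : sharpNorm (x - y) < Real.exp (-(m : ℝ))) :
    ∀ᶠ ε : Idx in small, ‖p ε - q ε‖ < (ε : ℝ) ^ m := by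
  simpa using (hp.sub hq).eventually_norm_lt h

theorem exists_sharpBall_subset_stronglyInternal {n : ℕ} {X : Set (EuclideanSpace ℝ (Fin n))}
    {B : Idx → Set (EuclideanSpace ℝ (Fin n))} {x : GenVec n} (hx : x ∈ stronglyInternal X B) :
    ∃ δ > 0, ∀ y ∈ compactPoints X, sharpNorm (y - x) < δ → y ∈ stronglyInternal X B := by
  obtain ⟨p, hp, hpX⟩ := exists_isRep_of_mem_compactPoints hx.1
  obtain ⟨m, hm⟩ := exists_pow_of_mem_stronglyInternal hx hp hpX
  -- One extra power of `ε` makes the sum of two distances below `ε ^ (m + 1)` less than `ε ^ m`.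
  refine ⟨_, exp_neg_nat_pos (m + 1), fun y hy hyx => ?_⟩
  obtain ⟨q, hq, hqX⟩ := exists_isRep_of_mem_compactPoints hy
  refine mem_stronglyInternal_of_pow hy hq (m := m + 1) ?_
  filter_upwards [hm, eventually_norm_sub_lt_of_sharpNorm hq hp hyx, eventually_two_mul_pow_lt m]
    with ε h1 h2 h3 z hz hzq
  refine h1 z hz ?_
  have := norm_sub_le_norm_sub_add_norm_sub z (q ε) (p ε)
  linarith

theorem exists_sharpBall_subset_compactPoints_univ {n : ℕ} {x : GenVec n}
    (hx : x ∈ compactPoints (Set.univ : Set (EuclideanSpace ℝ (Fin n)))) :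
    ∃ δ > 0, ∀ y, sharpNorm (y - x) < δ →
      y ∈ compactPoints (Set.univ : Set (EuclideanSpace ℝ (Fin n))) := by
  obtain ⟨K, hK, -, p, hp, hpK⟩ := hx
  -- Sharp distance below `e ^ 0 = 1` forces representatives within distance `ε ^ 0 = 1`, hence into
  -- a thickening of `K`.
  refine ⟨_, exp_neg_nat_pos 0, fun y hy => ?_⟩
  obtain ⟨q, hq⟩ := exists_isRep y
  refine ⟨Metric.cthickening 1 K, hK.cthickening, Set.subset_univ _, q, hq, ?_⟩
  filter_upwards [hpK, eventually_norm_sub_lt_of_sharpNorm hq hp hy] with ε h1 h2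
  refine Metric.mem_cthickening_of_dist_le _ _ _ _ h1 ?_
  rw [dist_eq_norm]
  simpa using h2.le

theorem isOpen_stronglyInternal_univ {n : ℕ} (B : Idx → Set (EuclideanSpace ℝ (Fin n))) :
    IsOpen (stronglyInternal Set.univ B) := by
  rw [isOpen_sharp_iff]
  intro x hx
  obtain ⟨δ, hδ, h⟩ := exists_sharpBall_subset_stronglyInternal hx
  obtain ⟨δ', hδ', h'⟩ := exists_sharpBall_subset_compactPoints_univ hx.1
  exact ⟨min δ δ', lt_min hδ hδ', fun y hy =>
    h y (h' y (hy.trans_le (min_le_right _ _))) (hy.trans_le (min_le_left _ _))⟩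

/-! ## Charts of a submanifold -/

namespace SubmanifoldAtlas

variable {N n : ℕ} {M : Set (EuclideanSpace ℝ (Fin N))} {r : ℝ} {Λ : Type*}
  (A : SubmanifoldAtlas M n r Λ)

theorem source_subset (α : Λ) : (A.chart α).source ⊆ M := by
  obtain ⟨O, -, h⟩ := A.source_open α
  rw [h]
  exact Set.inter_subset_left

theorem chart_mem_ball {α : Λ} {p : EuclideanSpace ℝ (Fin N)} (hp : p ∈ (A.chart α).source) :
    A.chart α p ∈ Metric.ball 0 r := by
  rw [← A.target_eq α]
  exact (A.chart α).map_source hp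

theorem symm_mem_source {α : Λ} {x : EuclideanSpace ℝ (Fin n)} (hx : x ∈ Metric.ball 0 r) :
    (A.chart α).symm x ∈ (A.chart α).source :=
  (A.chart α).map_target (by rwa [A.target_eq α])

theorem chart_symm_apply {α : Λ} {x : EuclideanSpace ℝ (Fin n)} (hx : x ∈ Metric.ball 0 r) :
    A.chart α ((A.chart α).symm x) = x :=
  (A.chart α).right_inv (by rwa [A.target_eq α])

theorem symm_chart_apply {α : Λ} {p : EuclideanSpace ℝ (Fin N)} (hp : p ∈ (A.chart α).source) :
    (A.chart α).symm (A.chart α p) = p :=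
  (A.chart α).left_inv hp

theorem continuousOn_symm (α : Λ) : ContinuousOn (A.chart α).symm (Metric.ball 0 r) :=
  (A.smooth_symm α).continuousOn

theorem exists_ball_subset_source {α : Λ} {p : EuclideanSpace ℝ (Fin N)}
    (hp : p ∈ (A.chart α).source) :
    ∃ δ > 0, ∀ z ∈ M, dist z p < δ → z ∈ (A.chart α).source := by
  obtain ⟨O, hO, h⟩ := A.source_open α
  rw [h] at hp ⊢
  obtain ⟨δ, hδ, hb⟩ := Metric.isOpen_iff.1 hO p hp.2
  exact ⟨δ, hδ, fun z hz hzp => ⟨hz, hb hzp⟩⟩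

theorem exists_chart {p : EuclideanSpace ℝ (Fin N)} (hp : p ∈ M) :
    ∃ α, p ∈ (A.chart α).source := by
  rw [A.cover] at hp
  simpa using hp

/-- A compact subset of a submanifold has a compact neighbourhood of uniform size in it. -/
theorem exists_compact_nhd (A : SubmanifoldAtlas M n r Λ) {K : Set (EuclideanSpace ℝ (Fin N))} (hK : IsCompact K) (hKM : K ⊆ M) :
    ∃ η > 0, ∃ K', IsCompact K' ∧ K' ⊆ M ∧ ∀ p ∈ K, ∀ z ∈ M, dist z p < η → z ∈ K' := by
  refine hK.induction_on (p := fun s => ∃ η > 0, ∃ K', IsCompact K' ∧ K' ⊆ M ∧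
    ∀ p ∈ s, ∀ z ∈ M, dist z p < η → z ∈ K') ?_ ?_ ?_ ?_
  · exact ⟨1, one_pos, ∅, isCompact_empty, Set.empty_subset _, fun p hp => hp.elim⟩
  · rintro s t hst ⟨η, hη, K', h1, h2, h3⟩
    exact ⟨η, hη, K', h1, h2, fun p hp => h3 p (hst hp)⟩
  · rintro s t ⟨η, hη, K', h1, h2, h3⟩ ⟨θ, hθ, L', h4, h5, h6⟩
    refine ⟨min η θ, lt_min hη hθ, K' ∪ L', h1.union h4, Set.union_subset h2 h5, ?_⟩
    rintro p (hp | hp) z hz hzp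
    · exact .inl (h3 p hp z hz (hzp.trans_le (min_le_left _ _)))
    · exact .inr (h6 p hp z hz (hzp.trans_le (min_le_right _ _)))
  · intro p hp
    obtain ⟨α, hα⟩ := A.exists_chart (hKM hp)
    obtain ⟨δ, hδ, h1⟩ := A.exists_ball_subset_source hα
    have h2 : Metric.ball (0 : EuclideanSpace ℝ (Fin n)) r ∈ 𝓝 (A.chart α p) :=
      Metric.isOpen_ball.mem_nhds (A.chart_mem_ball hα)
    obtain ⟨s, hs, h3⟩ := Metric.nhds_basis_closedBall.mem_iff.1 h2
    have h4 := A.continuousOn_chart α p hα (Metric.closedBall_mem_nhds _ hs)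
    obtain ⟨θ, hθ, h5⟩ := Metric.mem_nhdsWithin_iff.1 h4
    refine ⟨_, mem_nhdsWithin_of_mem_nhds (Metric.ball_mem_nhds p (half_pos (lt_min hδ hθ))),
      min δ θ / 2, half_pos (lt_min hδ hθ), (A.chart α).symm '' Metric.closedBall (A.chart α p) s,
      (isCompact_closedBall _ _).image_of_continuousOn ((A.continuousOn_symm α).mono h3), ?_, ?_⟩
    · rintro _ ⟨y, hy, rfl⟩
      exact A.source_subset α (A.symm_mem_source (h3 hy))
    · intro q hq z hz hzq
      have hq' : dist q p < min δ θ / 2 := hq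
      have hzp : dist z p < min δ θ := by linarith [dist_triangle z q p]
      have hzs := h1 z hz (hzp.trans_le (min_le_left _ _))
      refine ⟨A.chart α z, h5 ⟨hzp.trans_le (min_le_right _ _), hzs⟩, A.symm_chart_apply hzs⟩

/-- Nearby points of a submanifold are joined by small connected subsets. -/
theorem exists_preconnected {K : Set (EuclideanSpace ℝ (Fin N))} (hK : IsCompact K) (hKM : K ⊆ M)
    (hLip : A.IsBiLipschitz) :
    ∃ η > 0, ∃ C > 0, ∀ p ∈ K, ∀ z ∈ M, dist z p < η → ∃ S ⊆ M, IsPreconnected S ∧ p ∈ S ∧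
      z ∈ S ∧ ∀ w ∈ S, dist w p ≤ C * dist z p := by
  -- Compact induction passes through sets not contained in `M`, so membership in `M` is made a
  -- separate hypothesis.
  suffices h : ∃ η > 0, ∃ C > 0, ∀ p ∈ K, p ∈ M → ∀ z ∈ M, dist z p < η → ∃ S ⊆ M,
      IsPreconnected S ∧ p ∈ S ∧ z ∈ S ∧ ∀ w ∈ S, dist w p ≤ C * dist z p by
    obtain ⟨η, hη, C, hC, h⟩ := h
    exact ⟨η, hη, C, hC, fun p hp => h p hp (hKM hp)⟩
  refine hK.induction_on (p := fun s => ∃ η > 0, ∃ C > 0, ∀ p ∈ s, p ∈ M → ∀ z ∈ M, dist z p < η →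
    ∃ S ⊆ M, IsPreconnected S ∧ p ∈ S ∧ z ∈ S ∧ ∀ w ∈ S, dist w p ≤ C * dist z p) ?_ ?_ ?_ ?_
  · exact ⟨1, one_pos, 1, one_pos, fun p hp => hp.elim⟩
  · rintro s t hst ⟨η, hη, C, hC, h⟩
    exact ⟨η, hη, C, hC, fun p hp => h p (hst hp)⟩
  · rintro s t ⟨η, hη, C, hC, h⟩ ⟨θ, hθ, D, hD, h'⟩
    refine ⟨min η θ, lt_min hη hθ, max C D, lt_max_of_lt_left hC, ?_⟩
    rintro p (hp | hp) hpM z hz hzp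
    · obtain ⟨S, h1, h2, h3, h4, h5⟩ := h p hp hpM z hz (hzp.trans_le (min_le_left _ _))
      exact ⟨S, h1, h2, h3, h4, fun w hw => (h5 w hw).trans
        (mul_le_mul_of_nonneg_right (le_max_left _ _) dist_nonneg)⟩
    · obtain ⟨S, h1, h2, h3, h4, h5⟩ := h' p hp hpM z hz (hzp.trans_le (min_le_right _ _))
      exact ⟨S, h1, h2, h3, h4, fun w hw => (h5 w hw).trans
        (mul_le_mul_of_nonneg_right (le_max_right _ _) dist_nonneg)⟩
  · intro p₀ hp₀
    obtain ⟨β, hβ⟩ := A.exists_chart (hKM hp₀)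
    obtain ⟨δ, hδ, h1⟩ := A.exists_ball_subset_source hβ
    obtain ⟨⟨C₁, hC₁⟩, C₂, hC₂⟩ := hLip β
    refine ⟨_, mem_nhdsWithin_of_mem_nhds (Metric.ball_mem_nhds p₀ (half_pos hδ)),
      δ / 2, half_pos hδ, C₂ * C₁ + 1, by positivity, fun p hp hpM z hz hzp => ?_⟩
    have hp' : dist p p₀ < δ / 2 := hp
    have hps := h1 p hpM (by linarith)
    have hzs := h1 z hz (by linarith [dist_triangle z p p₀])
    have hseg : segment ℝ (A.chart β p) (A.chart β z) ⊆ Metric.ball 0 r :=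
      (convex_ball _ _).segment_subset (A.chart_mem_ball hps) (A.chart_mem_ball hzs)
    -- The connected set is the lift of a segment of the convex ball; its size is controlled by the
    -- two Lipschitz constants.
    refine ⟨(A.chart β).symm '' segment ℝ (A.chart β p) (A.chart β z), ?_, ?_, ?_, ?_, ?_⟩
    · rintro _ ⟨y, hy, rfl⟩
      exact A.source_subset β (A.symm_mem_source (hseg hy))
    · exact (convex_segment _ _).isPreconnected.image _ ((A.continuousOn_symm β).mono hseg)
    · exact ⟨_, left_mem_segment _ _ _, A.symm_chart_apply hps⟩
    · exact ⟨_, right_mem_segment _ _ _, A.symm_chart_apply hzs⟩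
    · rintro _ ⟨y, hy, rfl⟩
      have e1 : dist ((A.chart β).symm y) ((A.chart β).symm (A.chart β p)) ≤
          C₂ * dist y (A.chart β p) := hC₂.dist_le_mul _ (hseg hy) _ (A.chart_mem_ball hps)
      rw [A.symm_chart_apply hps] at e1
      have e2 : dist (A.chart β z) (A.chart β p) ≤ C₁ * dist z p := hC₁.dist_le_mul _ hzs _ hps
      have e3 : dist y (A.chart β p) ≤ dist (A.chart β z) (A.chart β p) := by
        rw [dist_eq_norm, dist_eq_norm]
        exact norm_sub_le_of_mem_segment hy
      have : (0 : ℝ) ≤ C₂ := C₂.2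
      nlinarith [dist_nonneg (x := z) (y := p), mul_le_mul_of_nonneg_left (e3.trans e2) this]

/-- A point of a compact set far from the boundary of a chart domain is mapped far from the
boundary of the ball. -/
theorem ball_subset_of_dist {K : Set (EuclideanSpace ℝ (Fin N))} (hr : 0 < r) (hK : IsCompact K)
    (hKM : K ⊆ M) :
    ∃ η > 0, ∀ (α : Λ) (C : NNReal), LipschitzOnWith C (A.chart α).symm (Metric.ball 0 r) →
      ∃ C' > 0, ∀ p ∈ K, p ∈ (A.chart α).source → ∀ ρ ≤ η,
      (∀ z ∈ M, dist z p < ρ → z ∈ (A.chart α).source) →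
      ∀ y, C' * dist y (A.chart α p) < ρ → y ∈ Metric.ball 0 r := by
  obtain ⟨η, hη, K', hK', hKM', h⟩ := A.exists_compact_nhd hK hKM
  refine ⟨η, hη, fun α C hC => ?_⟩
  -- A Lipschitz extension gives `φ_α⁻¹` values on the boundary sphere, at the price of a
  -- dimensional constant.
  obtain ⟨g, hg, hgeq⟩ := hC.extend_finite_dimension
  set C'' : NNReal := lipschitzExtensionConstant (EuclideanSpace ℝ (Fin N)) * C
  refine ⟨C'' + 1, by positivity, fun p hp hps ρ hρ hball y hy => ?_⟩
  by_contra hyb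
  have hq := A.chart_mem_ball hps
  set q := A.chart α p
  -- a boundary point on the segment from `q` to `y`
  obtain ⟨b, hb1, hb2⟩ : ∃ b, ‖b‖ = r ∧ dist b q ≤ dist y q := by
    have hcont : ContinuousOn (fun t : ℝ => ‖q + t • (y - q)‖) (Set.Icc 0 1) := by fun_prop
    have := intermediate_value_Icc zero_le_one hcont
    obtain ⟨t, ht, hbt⟩ := this (a := r) ⟨by simpa using (mem_ball_zero_iff.1 hq).le, by
      simpa using hyb⟩
    refine ⟨_, hbt, ?_⟩
    rw [dist_eq_norm, dist_eq_norm, add_sub_cancel_left, norm_smul, Real.norm_of_nonneg ht.1]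
    exact mul_le_of_le_one_left (norm_nonneg _) ht.2
  have hbcl : b ∈ closure (Metric.ball (0 : EuclideanSpace ℝ (Fin n)) r) := by
    rw [closure_ball _ hr.ne']
    simp [hb1]
  have hne : (𝓝[Metric.ball 0 r] b).NeBot := mem_closure_iff_nhdsWithin_neBot.1 hbcl
  have hgp : g q = p := by
    rw [← hgeq hq]
    exact A.symm_chart_apply hps
  have hgb : dist (g b) p < ρ := by
    have := hg.dist_le_mul b q
    rw [hgp] at this
    have h0 : (0 : ℝ) ≤ C'' := C''.2
    nlinarith [dist_nonneg (x := y) (y := q), mul_le_mul_of_nonneg_left hb2 h0]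
  have hlim : Filter.Tendsto (A.chart α).symm (𝓝[Metric.ball 0 r] b) (𝓝 (g b)) := by
    refine (hg.continuous.continuousAt.tendsto.mono_left nhdsWithin_le_nhds).congr' ?_
    filter_upwards [self_mem_nhdsWithin] with z hz using (hgeq hz).symm
  -- `M` need not be closed; the compact neighbourhood `K'` keeps the limit point `g b` in `M`.
  have hgK : g b ∈ K' := by
    refine hK'.isClosed.mem_of_tendsto hlim ?_
    filter_upwards [hlim (Metric.isOpen_ball.mem_nhds (show g b ∈ Metric.ball p ρ from hgb)),
      self_mem_nhdsWithin] with z hz hzb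
    exact h p hp _ (A.source_subset α (A.symm_mem_source hzb)) (lt_of_lt_of_le hz hρ)
  have hgs := hball _ (hKM' hgK) hgb
  -- As `z → b` in the ball, `φ_α (φ_α⁻¹ z) = z` tends both to `φ_α (g b)`, which is inside the
  -- ball, and to `b`, which is on the sphere.
  have hlim2 : Filter.Tendsto (fun z => A.chart α ((A.chart α).symm z)) (𝓝[Metric.ball 0 r] b)
      (𝓝 (A.chart α (g b))) := by
    refine (A.continuousOn_chart α _ hgs).tendsto.comp (tendsto_nhdsWithin_iff.2 ⟨hlim, ?_⟩)
    filter_upwards [self_mem_nhdsWithin] with z hz using A.symm_mem_source hz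
  have hlim3 : Filter.Tendsto (fun z => A.chart α ((A.chart α).symm z)) (𝓝[Metric.ball 0 r] b)
      (𝓝 b) := by
    refine (Filter.tendsto_id.mono_left nhdsWithin_le_nhds).congr' ?_
    filter_upwards [self_mem_nhdsWithin] with z hz using (A.chart_symm_apply hz).symm
  have hbb : b ∈ Metric.ball 0 r := by
    rw [tendsto_nhds_unique hlim3 hlim2]
    exact A.chart_mem_ball hgs
  rw [mem_ball_zero_iff, hb1] at hbb
  exact lt_irrefl _ hbb

/-- A point of a compact set mapped far from the boundary of the ball is far from the boundary of
the chart domain. -/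
theorem source_of_ball_subset {K : Set (EuclideanSpace ℝ (Fin N))} (hK : IsCompact K) (hKM : K ⊆ M)
    (hLip : A.IsBiLipschitz) :
    ∃ η > 0, ∀ (α : Λ) (C : NNReal), LipschitzOnWith C (A.chart α) (A.chart α).source →
      ∃ C' > 0, ∀ p ∈ K, p ∈ (A.chart α).source → ∀ ρ > 0,
      (∀ y, dist y (A.chart α p) < ρ → y ∈ Metric.ball 0 r) →
      ∀ z ∈ M, dist z p < η → C' * dist z p < ρ → z ∈ (A.chart α).source := by
  obtain ⟨η, hη, D, hD, h⟩ := A.exists_preconnected hK hKM hLip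
  -- The factor 2 keeps the images of points of `S` within `ρ / 2` of `φ_α p`; the added 1 ensures
  -- positivity.
  refine ⟨η, hη, fun α C hC => ⟨2 * C * D + 1, by positivity, fun p hp hps ρ hρ hball z hz hzp hzρ => ?_⟩⟩
  obtain ⟨S, hSM, hS, hpS, hzS, hdist⟩ := h p hp z hz hzp
  obtain ⟨O, hO, hsrc⟩ := A.source_open α
  have hsub : Metric.closedBall (A.chart α p) (ρ / 2) ⊆ Metric.ball 0 r := fun y hy =>
    hball y (lt_of_le_of_lt hy (by linarith))
  set T := (A.chart α).symm '' Metric.closedBall (A.chart α p) (ρ / 2)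
  have hT : IsCompact T :=
    (isCompact_closedBall _ _).image_of_continuousOn ((A.continuousOn_symm α).mono hsub)
  have hTs : T ⊆ (A.chart α).source := by
    rintro _ ⟨y, hy, rfl⟩
    exact A.symm_mem_source (hsub hy)
  have hST : ∀ w ∈ S, w ∈ (A.chart α).source → w ∈ T := fun w hw hws => by
    refine ⟨A.chart α w, ?_, A.symm_chart_apply hws⟩
    rw [Metric.mem_closedBall]
    have e1 := hC.dist_le_mul _ hws _ hps
    have h0 : (0 : ℝ) ≤ C := C.2
    nlinarith [mul_le_mul_of_nonneg_left (hdist w hw) h0, dist_nonneg (x := z) (y := p)]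
  -- On `S` the chart domain coincides with the compact set `T`, so it is both open and closed
  -- there; it contains `p`, hence all of the connected set `S`.
  have hcov : S ⊆ O ∪ Tᶜ := fun w hw => by
    by_cases hwT : w ∈ T
    · have := hTs hwT
      rw [hsrc] at this
      exact .inl this.2
    · exact .inr hwT
  have hdisj : S ∩ (O ∩ Tᶜ) = ∅ := by
    rw [Set.eq_empty_iff_forall_notMem]
    rintro w ⟨hw, hwO, hwT⟩
    exact hwT (hST w hw (by rw [hsrc]; exact ⟨hSM hw, hwO⟩))
  have hSO : S ⊆ O :=
    (isPreconnected_iff_subset_of_disjoint.1 hS O Tᶜ hO hT.isClosed.isOpen_compl hcov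
      hdisj).resolve_right fun h1 => h1 hpS (hST p hpS hps)
  rw [hsrc]
  exact ⟨hz, hSO hzS⟩

end SubmanifoldAtlas

/-! ### Generalized charts: isometry, images, covering and topology -/

theorem isModerate_of_norm_le {n : ℕ} {p : Net n} (C : ℝ) (h : ∀ᶠ ε in small, ‖p ε‖ ≤ C) :
    IsModerate (fun ε => ‖p ε‖) :=
  (isModerate_const C).mono (h.mono fun ε h => by
    rw [abs_norm]
    exact h.trans (le_abs_self C))

theorem exists_isRep_of_mem_isCompact {n : ℕ} {K : Set (EuclideanSpace ℝ (Fin n))}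
    (hK : IsCompact K) {p : Net n} (h : ∀ᶠ ε in small, p ε ∈ K) : ∃ x, IsRep p x := by
  obtain ⟨C, hC⟩ := hK.isBounded.exists_norm_le
  exact exists_isRep_of_isModerate (isModerate_of_norm_le C (h.mono fun ε h => hC _ h))

theorem eventually_pow_succ_lt {η : ℝ} (hη : 0 < η) (m : ℕ) :
    ∀ᶠ ε : Idx in small, (ε : ℝ) ^ (m + 1) < η := by
  filter_upwards [small_lt hη] with ε h
  exact lt_of_le_of_lt (pow_le_of_le_one ε.2.1.le ε.2.2 (Nat.succ_ne_zero m)) h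

theorem eventually_const_mul_pow_lt (C : ℝ) (m : ℕ) :
    ∀ᶠ ε : Idx in small, C * (ε : ℝ) ^ (m + 1) < (ε : ℝ) ^ m := by
  filter_upwards [eventually_const_mul_rpow_lt C (r := m) (s := (m + 1 : ℕ)) (by simp)] with ε h
  simpa only [Real.rpow_natCast] using h

theorem Set.Finite.exists_forall_comp_le {ι Λ : Type*} {l : ι → Λ} (hl : (Set.range l).Finite)
    (f : Λ → ℝ) : ∃ C > 0, ∀ i, f (l i) ≤ C := by
  obtain ⟨C, hC⟩ := (hl.image f).bddAbove
  exact ⟨max C 1, by positivity, fun i =>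
    (hC ⟨l i, ⟨i, rfl⟩, rfl⟩).trans (le_max_left _ _)⟩

theorem norm_chart_sub_le_aux {N n : ℕ} {f : EuclideanSpace ℝ (Fin N) → EuclideanSpace ℝ (Fin n)}
    {s : Set (EuclideanSpace ℝ (Fin N))} {C : NNReal} (h : LipschitzOnWith C f s) {D : ℝ}
    (hD : C ≤ D) {x y : EuclideanSpace ℝ (Fin N)} (hx : x ∈ s) (hy : y ∈ s) :
    ‖f x - f y‖ ≤ D * ‖x - y‖ := by
  have := h.dist_le_mul x hx y hy
  rw [dist_eq_norm, dist_eq_norm] at this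
  exact this.trans (mul_le_mul_of_nonneg_right hD (norm_nonneg _))

namespace SubmanifoldAtlas

variable {N n : ℕ} {M : Set (EuclideanSpace ℝ (Fin N))} {r : ℝ} {Λ : Type*}
  {A : SubmanifoldAtlas M n r Λ}

theorem IsBiLipschitz.exists_forall_norm_le (hLip : A.IsBiLipschitz) {l : Idx → Λ}
    (hl : (Set.range l).Finite) : ∃ C > 0, ∀ ε,
      (∀ p ∈ (A.chart (l ε)).source, ∀ q ∈ (A.chart (l ε)).source,
        ‖A.chart (l ε) p - A.chart (l ε) q‖ ≤ C * ‖p - q‖) ∧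
      (∀ x ∈ Metric.ball 0 r, ∀ y ∈ Metric.ball 0 r,
        ‖(A.chart (l ε)).symm x - (A.chart (l ε)).symm y‖ ≤ C * ‖x - y‖) := by
  choose h1 h2 using hLip
  choose C hC using h1
  choose D hD using h2
  obtain ⟨E, hE0, hE⟩ := hl.exists_forall_comp_le fun α => max (C α : ℝ) (D α)
  refine ⟨E, hE0, fun ε => ⟨fun p hp q hq => ?_, fun x hx y hy => ?_⟩⟩
  · exact norm_chart_sub_le_aux (hC _) ((le_max_left _ _).trans (hE ε)) hp hq
  · exact norm_chart_sub_le_aux (hD _) ((le_max_right _ _).trans (hE ε)) hx hy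

/-- Independence of the choice made in `genChart`: uniformly Lipschitz charts turn a negligible
change of representative into a negligible change of image. -/
theorem isRep_genChart (hLip : A.IsBiLipschitz) {l : Idx → Λ} (hl : (Set.range l).Finite)
    {x : GenVec N} (hx : x ∈ A.genDomain l) {p : Net N} (hp : IsRep p x)
    (hpM : ∀ᶠ ε in small, p ε ∈ M) : IsRep (fun ε => A.chart (l ε) (p ε)) (A.genChart l x) := by
  obtain ⟨C, -, hC⟩ := hLip.exists_forall_norm_le hl
  have hps := hx.2 p hp hpM
  obtain ⟨y, hy⟩ := exists_isRep_of_isModerate (p := fun ε => A.chart (l ε) (p ε))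
    (isModerate_of_norm_le r (hps.mono fun ε h => (mem_ball_zero_iff.1 (A.chart_mem_ball h)).le))
  have H : ∃ y : GenVec n, ∃ p : Net N, IsRep p x ∧
      (∀ᶠ ε in small, p ε ∈ (A.chart (l ε)).source) ∧ IsRep (fun ε => A.chart (l ε) (p ε)) y :=
    ⟨y, p, hp, hps, hy⟩
  rw [genChart, dif_pos H]
  obtain ⟨q, hq, hqs, hqy⟩ := H.choose_spec
  refine hqy.of_isNegligible_sub
    (((isModerate_const C).mul_isNegligible (hp.isNegligible_sub hq)).mono ?_)
  filter_upwards [hps, hqs] with ε h1 h2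
  rw [abs_norm]
  exact ((hC ε).1 _ h1 _ h2).trans (le_abs_self _)

theorem sharpNorm_genChart_sub (hLip : A.IsBiLipschitz) {l : Idx → Λ} (hl : (Set.range l).Finite)
    {x y : GenVec N} (hx : x ∈ A.genDomain l) (hy : y ∈ A.genDomain l) :
    sharpNorm (A.genChart l x - A.genChart l y) = sharpNorm (x - y) := by
  obtain ⟨C, -, hC⟩ := hLip.exists_forall_norm_le hl
  obtain ⟨p, hp, hpM⟩ := exists_isRep_of_mem_compactPoints hx.1
  obtain ⟨q, hq, hqM⟩ := exists_isRep_of_mem_compactPoints hy.1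
  have h1 := (isRep_genChart hLip hl hx hp hpM).sub (isRep_genChart hLip hl hy hq hqM)
  have h2 := hp.sub hq
  apply le_antisymm
  · refine sharpNorm_le_of_norm_le C h1 h2 ?_
    filter_upwards [hx.2 p hp hpM, hy.2 q hq hqM] with ε e1 e2 using (hC ε).1 _ e1 _ e2
  · refine sharpNorm_le_of_norm_le C h2 h1 ?_
    filter_upwards [hx.2 p hp hpM, hy.2 q hq hqM] with ε e1 e2
    have := (hC ε).2 _ (A.chart_mem_ball e1) _ (A.chart_mem_ball e2)
    rwa [A.symm_chart_apply e1, A.symm_chart_apply e2] at this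

theorem injOn_genChart (hLip : A.IsBiLipschitz) {l : Idx → Λ} (hl : (Set.range l).Finite) :
    Set.InjOn (A.genChart l) (A.genDomain l) := fun x hx y hy h => by
  refine sub_eq_zero.1 (sharpNorm_eq_zero ?_)
  rw [← sharpNorm_genChart_sub hLip hl hx hy, h, sub_self, sharpNorm_zero]

theorem mapsTo_genChart (hr : 0 < r) (hLip : A.IsBiLipschitz) {l : Idx → Λ}
    (hl : (Set.range l).Finite) : Set.MapsTo (A.genChart l) (A.genDomain l)
      (stronglyInternal Set.univ (fun _ => Metric.ball 0 r)) := by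
  intro x hx
  obtain ⟨K, hK, hKM, p, hp, hpK⟩ := hx.1
  have hpM : ∀ᶠ ε in small, p ε ∈ M := hpK.mono fun ε h => hKM h
  have hps := hx.2 p hp hpM
  obtain ⟨m, hm⟩ := exists_pow_of_mem_stronglyInternal hx hp hpM
  obtain ⟨η, hη, h⟩ := A.ball_subset_of_dist hr hK hKM
  choose D hD using fun α => (hLip α).2
  choose C hC h' using fun α => h α (D α) (hD α)
  obtain ⟨E, hE0, hE⟩ := hl.exists_forall_comp_le C
  have hrep := isRep_genChart hLip hl hx hp hpM
  -- The radius in `M` is `ρ = ε ^ (m + 1)`, which falls below `η` even when `m = 0`; the second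
  -- extra power absorbs the constant `E`.
  refine mem_stronglyInternal_of_pow (m := m + 1 + 1)
    ⟨_, isCompact_closedBall 0 r, Set.subset_univ _, _, hrep, hps.mono fun ε h1 =>
      Metric.ball_subset_closedBall (A.chart_mem_ball h1)⟩ hrep ?_
  filter_upwards [hpK, hps, hm, eventually_pow_succ_lt hη m, eventually_const_mul_pow_lt E (m + 1),
    eventually_two_mul_pow_lt m] with ε h1 h2 h3 h4 h5 h6 y _ hy
  have h7 := pow_pos ε.2.1 (m + 1)
  refine h' (l ε) (p ε) h1 h2 _ h4.le (fun z hz hzp => h3 z hz ?_) y ?_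
  · rw [← dist_eq_norm]
    linarith
  · rw [dist_eq_norm]
    refine lt_of_le_of_lt (mul_le_mul (hE ε) hy.le (norm_nonneg _) hE0.le) h5

theorem genChart_eq_of_isRep_symm (hLip : A.IsBiLipschitz) {l : Idx → Λ}
    (hl : (Set.range l).Finite) {x : GenVec N} (hx : x ∈ A.genDomain l) {q : Net n} {y : GenVec n}
    (hq : IsRep q y) (hqb : ∀ᶠ ε in small, q ε ∈ Metric.ball 0 r)
    (h : IsRep (fun ε => (A.chart (l ε)).symm (q ε)) x) : A.genChart l x = y := by
  have h1 := isRep_genChart hLip hl hx h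
    (hqb.mono fun ε h => A.source_subset _ (A.symm_mem_source h))
  exact h1.unique (hq.congr (hqb.mono fun ε h => A.chart_symm_apply h))

theorem genChart_image_eq (hr : 0 < r) (hLip : A.IsBiLipschitz) {l : Idx → Λ}
    (hl : (Set.range l).Finite) (hc : ∀ ε, A.IsRelCompact (l ε)) :
    A.genChart l '' A.genDomain l = stronglyInternal Set.univ (fun _ => Metric.ball 0 r) := by
  refine Set.Subset.antisymm (mapsTo_genChart hr hLip hl).image_subset fun y hy => ?_
  obtain ⟨q, hq⟩ := exists_isRep y
  have hqb := hy.2 q hq (.of_forall fun _ => Set.mem_univ _)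
  obtain ⟨m, hm⟩ := exists_pow_of_mem_stronglyInternal hy hq (.of_forall fun _ => Set.mem_univ _)
  have hc' : ∀ α ∈ Set.range l, A.IsRelCompact α := by rintro _ ⟨ε, rfl⟩; exact hc ε
  choose! L hL hLM hL' using hc'
  -- Relative compactness and finite range put the whole pulled back net in one compact subset of
  -- `M`.
  set K := ⋃ α ∈ Set.range l, L α
  have hK : IsCompact K := hl.isCompact_biUnion hL
  have hKM : K ⊆ M := Set.iUnion₂_subset hLM
  set p : Net N := fun ε => (A.chart (l ε)).symm (q ε)
  have hps : ∀ᶠ ε in small, p ε ∈ (A.chart (l ε)).source := hqb.mono fun ε h => A.symm_mem_source h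
  have hpK : ∀ᶠ ε in small, p ε ∈ K := hps.mono fun ε h =>
    Set.mem_iUnion₂.2 ⟨l ε, ⟨ε, rfl⟩, hL' _ ⟨ε, rfl⟩ h⟩
  obtain ⟨x, hx⟩ := exists_isRep_of_mem_isCompact hK hpK
  obtain ⟨η, hη, h⟩ := A.source_of_ball_subset hK hKM hLip
  choose D hD using fun α => (hLip α).1
  choose C hC h' using fun α => h α (D α) (hD α)
  obtain ⟨E, hE0, hE⟩ := hl.exists_forall_comp_le C
  have hxd : x ∈ A.genDomain l := by
    refine mem_stronglyInternal_of_pow (m := m + 1) ⟨K, hK, hKM, p, hx, hpK⟩ hx ?_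
    filter_upwards [hpK, hps, hm, eventually_pow_succ_lt hη m, eventually_const_mul_pow_lt E m, hqb]
      with ε h1 h2 h3 h4 h5 h6 z hz hzp
    refine h' (l ε) (p ε) h1 h2 _ (pow_pos ε.2.1 m) (fun y hy => h3 y trivial ?_) z hz ?_ ?_
    · rwa [A.chart_symm_apply h6, dist_eq_norm] at hy
    · rw [dist_eq_norm]
      exact hzp.trans h4
    · rw [dist_eq_norm]
      exact lt_of_le_of_lt (mul_le_mul (hE ε) hzp.le (norm_nonneg _) hE0.le) h5
  exact ⟨x, hxd, genChart_eq_of_isRep_symm hLip hl hxd hq hqb hx⟩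

/-- No relative compactness is needed here: a net close to the image of `p` pulls back close to `p`,
hence into a compact neighbourhood of `K` in `M`. -/
theorem exists_sharpBall_subset_image (hr : 0 < r) (hLip : A.IsBiLipschitz) {l : Idx → Λ}
    (hl : (Set.range l).Finite) {x : GenVec N} (hx : x ∈ A.genDomain l) :
    ∃ δ > 0, ∀ y, sharpNorm (y - A.genChart l x) < δ → y ∈ A.genChart l '' A.genDomain l := by
  obtain ⟨C, -, hC⟩ := hLip.exists_forall_norm_le hl
  obtain ⟨K, hK, hKM, p, hp, hpK⟩ := hx.1
  have hpM : ∀ᶠ ε in small, p ε ∈ M := hpK.mono fun ε h => hKM h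
  have hps := hx.2 p hp hpM
  obtain ⟨m, hm⟩ := exists_pow_of_mem_stronglyInternal hx hp hpM
  obtain ⟨η, hη, K', hK', hKM', h⟩ := A.exists_compact_nhd hK hKM
  obtain ⟨δ, hδ, hball⟩ := isOpen_sharp_iff.1 (isOpen_stronglyInternal_univ _) _
    (mapsTo_genChart hr hLip hl hx)
  refine ⟨min δ _, lt_min hδ (exp_neg_nat_pos (m + 1 + 1)), fun y hy => ?_⟩
  obtain ⟨q, hq⟩ := exists_isRep y
  have hqb := (hball y (hy.trans_le (min_le_left _ _))).2 q hq (.of_forall fun _ => trivial)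
  have hqp := eventually_norm_sub_lt_of_sharpNorm hq (isRep_genChart hLip hl hx hp hpM)
    (hy.trans_le (min_le_right _ _))
  have hclose : ∀ᶠ ε in small, ‖(A.chart (l ε)).symm (q ε) - p ε‖ < (ε : ℝ) ^ (m + 1) := by
    filter_upwards [hqb, hqp, hps, eventually_const_mul_pow_lt |C| (m + 1)] with ε h1 h2 h3 h4
    have h5 := (hC ε).2 _ h1 _ (A.chart_mem_ball h3)
    rw [A.symm_chart_apply h3] at h5
    refine lt_of_le_of_lt (h5.trans ?_) h4
    exact mul_le_mul (le_abs_self C) h2.le (norm_nonneg _) (abs_nonneg _)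
  have hK'' : ∀ᶠ ε in small, (A.chart (l ε)).symm (q ε) ∈ K' := by
    filter_upwards [hclose, hpK, hqb, eventually_pow_succ_lt hη m] with ε h1 h2 h3 h4
    refine h _ h2 _ (A.source_subset _ (A.symm_mem_source h3)) ?_
    rw [dist_eq_norm]
    exact h1.trans h4
  obtain ⟨x', hx'⟩ := exists_isRep_of_mem_isCompact hK' hK''
  have hxd : x' ∈ A.genDomain l := by
    refine mem_stronglyInternal_of_pow (m := m + 1) ⟨K', hK', hKM', _, hx', hK''⟩ hx' ?_
    filter_upwards [hm, hclose, eventually_two_mul_pow_lt m] with ε h1 h2 h3 z hz hzq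
    refine h1 z hz ?_
    have := norm_sub_le_norm_sub_add_norm_sub z ((A.chart (l ε)).symm (q ε)) (p ε)
    linarith
  exact ⟨x', hxd, genChart_eq_of_isRep_symm hLip hl hxd hq hqb hx'⟩

theorem isOpen_genChart_image_iff (hr : 0 < r) (hLip : A.IsBiLipschitz) {l : Idx → Λ}
    (hl : (Set.range l).Finite) {V : Set (GenVec N)} (hV : V ⊆ A.genDomain l) :
    IsOpen (Subtype.val ⁻¹' V : Set (compactPoints M)) ↔ IsOpen (A.genChart l '' V) := by
  rw [isOpen_preimage_val_iff, isOpen_sharp_iff]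
  constructor
  · rintro h _ ⟨x, hx, rfl⟩
    obtain ⟨δ, hδ, h1⟩ := h x hx (hV hx).1
    obtain ⟨δ', hδ', h2⟩ := exists_sharpBall_subset_image hr hLip hl (hV hx)
    refine ⟨min δ δ', lt_min hδ hδ', fun y hy => ?_⟩
    obtain ⟨x', hx', rfl⟩ := h2 y (hy.trans_le (min_le_right _ _))
    rw [sharpNorm_genChart_sub hLip hl hx' (hV hx)] at hy
    exact ⟨x', h1 x' hx'.1 (hy.trans_le (min_le_left _ _)), rfl⟩
  · intro h x hx _
    obtain ⟨δ, hδ, h1⟩ := h _ ⟨x, hx, rfl⟩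
    obtain ⟨δ', hδ', h2⟩ := exists_sharpBall_subset_stronglyInternal (hV hx)
    refine ⟨min δ δ', lt_min hδ hδ', fun y hyM hy => ?_⟩
    have hyd : y ∈ A.genDomain l := h2 y hyM (hy.trans_le (min_le_right _ _))
    obtain ⟨y', hy', e⟩ := h1 (A.genChart l y) (by
      rw [sharpNorm_genChart_sub hLip hl hyd (hV hx)]
      exact hy.trans_le (min_le_left _ _))
    rwa [← injOn_genChart hLip hl (hV hy') hyd e]

theorem isOpen_preimage_genDomain (A : SubmanifoldAtlas M n r Λ) (l : Idx → Λ) :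
    IsOpen (Subtype.val ⁻¹' A.genDomain l : Set (compactPoints M)) := by
  rw [isOpen_preimage_val_iff]
  exact fun x hx _ => exists_sharpBall_subset_stronglyInternal hx

/-- A finite subcover of the compact set and its Lebesgue number `δ` provide, for each `ε`, one of
finitely many charts containing all points of `M` within `δ` of `p ε`. -/
theorem compactPoints_eq_iUnion (A : SubmanifoldAtlas M n r Λ) :
    compactPoints M = ⋃ l ∈ {l : Idx → Λ | (Set.range l).Finite}, A.genDomain l := by
  classical
  refine Set.Subset.antisymm (fun x hx => ?_) (Set.iUnion₂_subset fun l _ x hx => hx.1)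
  obtain ⟨K, hK, hKM, p, hp, hpK⟩ := id hx
  choose O hO hsrc using A.source_open
  have hcov : K ⊆ ⋃ α, O α := fun z hz => by
    obtain ⟨α, hα⟩ := A.exists_chart (hKM hz)
    rw [hsrc] at hα
    exact Set.mem_iUnion.2 ⟨α, hα.2⟩
  obtain ⟨t, ht⟩ := hK.elim_finite_subcover O hO hcov
  obtain ⟨δ, hδ, h⟩ := lebesgue_number_lemma_of_metric (c := fun α : t => O α) hK
    (fun α => hO α) (by simpa [Set.iUnion_subtype] using ht)
  -- One point of `K` shows that the finite subcover is nonempty, which supplies a default chart for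
  -- parameters where `p ε` is outside `K`.
  obtain ⟨ε₀, hε₀⟩ := hpK.exists
  obtain ⟨α₀, -⟩ := h _ hε₀
  have : Nonempty t := ⟨α₀⟩
  choose! f hf using h
  refine Set.mem_iUnion₂.2 ⟨fun ε => if p ε ∈ K then (f (p ε) : Λ) else α₀, ?_, ?_⟩
  · refine t.finite_toSet.subset ?_
    rintro _ ⟨ε, rfl⟩
    dsimp only
    split_ifs
    · exact (f (p ε)).2
    · exact α₀.2
  -- The fixed distance `δ` eventually exceeds `ε = ε ^ 1`.
  · refine mem_stronglyInternal_of_pow (m := 1) hx hp ?_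
    filter_upwards [hpK, small_lt hδ] with ε h1 h2 z hz hzp
    rw [if_pos h1, hsrc]
    refine ⟨hz, hf _ h1 ?_⟩
    rw [Metric.mem_ball, dist_eq_norm]
    rw [pow_one] at hzp
    exact hzp.trans h2

/-- The right-hand side does not involve `τ`; this yields uniqueness. It holds because the domains
are open for `τ` and cover. -/
theorem IsChartTopology.isOpen_iff {τ : TopologicalSpace (compactPoints M)}
    (hτ : A.IsChartTopology τ) {W : Set (compactPoints M)} :
    IsOpen[τ] W ↔ ∀ l : Idx → Λ, (Set.range l).Finite →
      IsOpen (A.genChart l '' (Subtype.val '' W ∩ A.genDomain l)) := by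
  have hpre : ∀ l, (Subtype.val ⁻¹' (Subtype.val '' W ∩ A.genDomain l) : Set (compactPoints M)) =
      W ∩ Subtype.val ⁻¹' A.genDomain l := fun l => by
    rw [Set.preimage_inter, Set.preimage_image_eq _ Subtype.val_injective]
  constructor
  · intro hW l hl
    rw [← (hτ l hl).2.2 _ Set.inter_subset_right, hpre]
    exact @IsOpen.inter _ τ _ _ hW (hτ l hl).2.1
  · intro h
    have hW : W = ⋃ l ∈ {l : Idx → Λ | (Set.range l).Finite},
        W ∩ Subtype.val ⁻¹' A.genDomain l := by
      refine Set.Subset.antisymm (fun x hx => ?_) (Set.iUnion₂_subset fun l _ =>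
        Set.inter_subset_left)
      obtain ⟨l, hl, hxl⟩ := Set.mem_iUnion₂.1 (A.compactPoints_eq_iUnion.subset x.2)
      exact Set.mem_iUnion₂.2 ⟨l, hl, hx, hxl⟩
    rw [hW]
    refine @isOpen_biUnion _ _ τ _ _ fun l hl => ?_
    rw [← hpre, (hτ l hl).2.2 _ Set.inter_subset_right]
    exact h l hl

theorem isChartTopology_induced (hr : 0 < r) (hLip : A.IsBiLipschitz) :
    A.IsChartTopology instTopologicalSpaceSubtype := fun l hl =>
  ⟨injOn_genChart hLip hl, A.isOpen_preimage_genDomain l, fun _ hV =>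
    isOpen_genChart_image_iff hr hLip hl hV⟩

theorem isChartTopology_iff (hr : 0 < r) (hLip : A.IsBiLipschitz)
    (τ : TopologicalSpace (compactPoints M)) :
    A.IsChartTopology τ ↔ τ = instTopologicalSpaceSubtype := by
  refine ⟨fun hτ => TopologicalSpace.ext ?_, ?_⟩
  · ext W
    exact hτ.isOpen_iff.trans (isChartTopology_induced hr hLip).isOpen_iff.symm
  · rintro rfl
    exact isChartTopology_induced hr hLip

end SubmanifoldAtlas

/-! ## Moderate smooth nets of maps -/

section NetCalculus

variable {n : ℕ}

/-- A set of nets is open if it contains with each net all nets in some polynomial tube. -/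
def IsOpenNets (D : Set (Net n)) : Prop :=
  ∀ p ∈ D, ∃ m : ℕ, ∀ q : Net n, (∀ᶠ ε : Idx in small, ‖q ε - p ε‖ < (ε : ℝ) ^ m) → q ∈ D

/-- A net of maps is smooth along the nets of `D`. -/
def NetSmooth {F : Type} [NormedAddCommGroup F] [NormedSpace ℝ F] (D : Set (Net n))
    (h : Idx → EuclideanSpace ℝ (Fin n) → F) : Prop :=
  ∀ p ∈ D, ∀ᶠ ε in small, ContDiffAt ℝ ∞ (h ε) (p ε)

/-- The derivatives up to order `k` of a net of maps are moderate along the nets of `D`. -/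
def NetModerate (D : Set (Net n)) : ∀ (_ : ℕ) {F : Type} [NormedAddCommGroup F] [NormedSpace ℝ F],
    (Idx → EuclideanSpace ℝ (Fin n) → F) → Prop
  | 0, _, _, _, h => ∀ p ∈ D, IsModerate (fun ε => ‖h ε (p ε)‖)
  | k + 1, _, _, _, h => (∀ p ∈ D, IsModerate (fun ε => ‖h ε (p ε)‖)) ∧
      NetModerate D k (fun ε => fderiv ℝ (h ε))

variable {D : Set (Net n)} {F G H : Type} [NormedAddCommGroup F] [NormedSpace ℝ F]
  [NormedAddCommGroup G] [NormedSpace ℝ G] [NormedAddCommGroup H] [NormedSpace ℝ H]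

/-- A single net tests a whole tube: take a counterexample at each `ε` where there is one. That net
still belongs to `D`. -/
theorem IsOpenNets.exists_pow (hD : IsOpenNets D) {P : Idx → EuclideanSpace ℝ (Fin n) → Prop}
    (h : ∀ p ∈ D, ∀ᶠ ε in small, P ε (p ε)) {p : Net n} (hp : p ∈ D) :
    ∃ m : ℕ, ∀ᶠ ε : Idx in small, ∀ z, ‖z - p ε‖ < (ε : ℝ) ^ m → P ε z := by
  classical
  obtain ⟨m, hm⟩ := hD p hp
  refine ⟨m, ?_⟩
  have hq : ∀ ε : Idx, ∃ z, ‖z - p ε‖ < (ε : ℝ) ^ m ∧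
      (P ε z → ∀ z, ‖z - p ε‖ < (ε : ℝ) ^ m → P ε z) := fun ε => by
    by_cases H : ∃ z, ‖z - p ε‖ < (ε : ℝ) ^ m ∧ ¬ P ε z
    · obtain ⟨z, h1, h2⟩ := H
      exact ⟨z, h1, fun h => absurd h h2⟩
    · push Not at H
      exact ⟨p ε, by simpa using pow_pos ε.2.1 m, fun _ => H⟩
  choose q hq1 hq2 using hq
  exact (h q (hm q (.of_forall hq1))).mono fun ε => hq2 ε

/-- This allows identities known only along the nets of `D` to be differentiated. -/
theorem IsOpenNets.eventually_nhds (hD : IsOpenNets D)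
    {P : Idx → EuclideanSpace ℝ (Fin n) → Prop} (h : ∀ p ∈ D, ∀ᶠ ε in small, P ε (p ε))
    {p : Net n} (hp : p ∈ D) : ∀ᶠ ε in small, ∀ᶠ z in 𝓝 (p ε), P ε z := by
  obtain ⟨m, hm⟩ := hD.exists_pow h hp
  filter_upwards [hm] with ε h1
  filter_upwards [Metric.ball_mem_nhds (p ε) (pow_pos ε.2.1 m)] with z hz
  exact h1 z (by rwa [← dist_eq_norm])

theorem NetSmooth.differentiableAt {h : Idx → EuclideanSpace ℝ (Fin n) → F} (hh : NetSmooth D h)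
    {p : Net n} (hp : p ∈ D) : ∀ᶠ ε in small, DifferentiableAt ℝ (h ε) (p ε) :=
  (hh p hp).mono fun _ h => h.differentiableAt (by simp)

theorem NetSmooth.fderiv_net {h : Idx → EuclideanSpace ℝ (Fin n) → F} (hh : NetSmooth D h) :
    NetSmooth D (fun ε => fderiv ℝ (h ε)) := fun p hp =>
  (hh p hp).mono fun _ h => h.fderiv_right (by simp)

theorem NetModerate.zero {k : ℕ} {h : Idx → EuclideanSpace ℝ (Fin n) → F}
    (hh : NetModerate D k h) {p : Net n} (hp : p ∈ D) : IsModerate (fun ε => ‖h ε (p ε)‖) := by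
  cases k with
  | zero => exact hh p hp
  | succ k => exact hh.1 p hp

theorem NetModerate.of_succ {k : ℕ} {h : Idx → EuclideanSpace ℝ (Fin n) → F}
    (hh : NetModerate D (k + 1) h) : NetModerate D k h := by
  induction k generalizing F with
  | zero => exact hh.1
  | succ k ih => exact ⟨hh.1, ih hh.2⟩

theorem NetModerate.congr (hD : IsOpenNets D) {k : ℕ} {a b : Idx → EuclideanSpace ℝ (Fin n) → F}
    (hb : NetModerate D k b) (h : ∀ p ∈ D, ∀ᶠ ε in small, a ε (p ε) = b ε (p ε)) :
    NetModerate D k a := by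
  have h0 : ∀ p ∈ D, IsModerate (fun ε => ‖a ε (p ε)‖) := fun p hp =>
    (hb.zero hp).mono ((h p hp).mono fun ε e => by rw [e])
  induction k generalizing F with
  | zero => exact h0
  | succ k ih =>
    have h1 : ∀ p ∈ D, ∀ᶠ ε in small, fderiv ℝ (a ε) (p ε) = fderiv ℝ (b ε) (p ε) :=
      fun p hp => (hD.eventually_nhds h hp).mono fun ε e => Filter.EventuallyEq.fderiv_eq e
    exact ⟨h0, ih hb.2 h1 fun p hp => (hb.2.zero hp).mono ((h1 p hp).mono fun ε e => by rw [e])⟩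

theorem NetModerate.of_iteratedFDeriv {h : Idx → EuclideanSpace ℝ (Fin n) → F}
    (hh : ∀ j, ∀ p ∈ D, IsModerate (fun ε => ‖iteratedFDeriv ℝ j (h ε) (p ε)‖)) (k : ℕ) :
    NetModerate D k h := by
  have h0 : ∀ p ∈ D, IsModerate (fun ε => ‖h ε (p ε)‖) := fun p hp => by
    simpa only [norm_iteratedFDeriv_zero] using hh 0 p hp
  induction k generalizing F with
  | zero => exact h0
  | succ k ih =>
    refine ⟨h0, ih (fun j p hp => ?_) fun p hp => ?_⟩
    · simpa only [norm_iteratedFDeriv_fderiv] using hh (j + 1) p hp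
    · simpa only [← norm_iteratedFDeriv_fderiv, norm_iteratedFDeriv_zero] using hh 1 p hp

theorem NetSmooth.add {a b : Idx → EuclideanSpace ℝ (Fin n) → F} (ha : NetSmooth D a)
    (hb : NetSmooth D b) : NetSmooth D (fun ε z => a ε z + b ε z) := fun p hp => by
  filter_upwards [ha p hp, hb p hp] with ε h1 h2 using ContDiffAt.add h1 h2

theorem NetModerate.add (hD : IsOpenNets D) {k : ℕ} {a b : Idx → EuclideanSpace ℝ (Fin n) → F}
    (ha : NetModerate D k a) (hb : NetModerate D k b) (ha' : NetSmooth D a)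
    (hb' : NetSmooth D b) : NetModerate D k (fun ε z => a ε z + b ε z) := by
  have h0 : ∀ p ∈ D, IsModerate (fun ε => ‖a ε (p ε) + b ε (p ε)‖) := fun p hp =>
    ((ha.zero hp).add (hb.zero hp)).mono (.of_forall fun ε => by
      rw [abs_norm]
      exact (norm_add_le _ _).trans (le_abs_self _))
  induction k generalizing F with
  | zero => exact h0
  | succ k ih =>
    refine ⟨h0, NetModerate.congr hD (ih ha.2 hb.2 ha'.fderiv_net hb'.fderiv_net fun p hp => ?_) ?_⟩
    · exact ((ha.2.zero hp).add (hb.2.zero hp)).mono (.of_forall fun ε => by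
        rw [abs_norm]
        exact (norm_add_le _ _).trans (le_abs_self _))
    · intro p hp
      filter_upwards [ha'.differentiableAt hp, hb'.differentiableAt hp] with ε h1 h2
      exact fderiv_add h1 h2

theorem NetModerate.clm (hD : IsOpenNets D) {k : ℕ} {a : Idx → EuclideanSpace ℝ (Fin n) → F}
    (L : F →L[ℝ] G) (ha : NetModerate D k a) (ha' : NetSmooth D a) :
    NetModerate D k (fun ε z => L (a ε z)) := by
  induction k generalizing F G with
  | zero =>
    intro p hp
    refine ((isModerate_const ‖L‖).mul (ha p hp)).mono (.of_forall fun ε => ?_)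
    rw [abs_norm]
    exact (L.le_opNorm _).trans (le_abs_self _)
  | succ k ih =>
    refine ⟨fun p hp => (ih L ha.of_succ ha').zero hp, NetModerate.congr hD
      (ih (ContinuousLinearMap.compL ℝ (EuclideanSpace ℝ (Fin n)) F G L) ha.2 ha'.fderiv_net) ?_⟩
    intro p hp
    filter_upwards [ha'.differentiableAt hp] with ε h1
    exact (L.hasFDerivAt.comp _ h1.hasFDerivAt).fderiv

theorem NetSmooth.clm {a : Idx → EuclideanSpace ℝ (Fin n) → F} (L : F →L[ℝ] G)
    (ha : NetSmooth D a) : NetSmooth D (fun ε z => L (a ε z)) := fun p hp =>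
  (ha p hp).mono fun _ h => L.contDiff.contDiffAt.comp _ h

theorem NetSmooth.bilinear {a : Idx → EuclideanSpace ℝ (Fin n) → F}
    {b : Idx → EuclideanSpace ℝ (Fin n) → G} (B : F →L[ℝ] G →L[ℝ] H)
    (ha : NetSmooth D a) (hb : NetSmooth D b) : NetSmooth D (fun ε z => B (a ε z) (b ε z)) :=
  fun p hp => by
    filter_upwards [ha p hp, hb p hp] with ε h1 h2
    exact (B.contDiff.contDiffAt.comp _ h1).clm_apply h2

theorem NetModerate.bilinear (hD : IsOpenNets D) {k : ℕ}
    {a : Idx → EuclideanSpace ℝ (Fin n) → F} {b : Idx → EuclideanSpace ℝ (Fin n) → G}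
    (B : F →L[ℝ] G →L[ℝ] H) (ha : NetModerate D k a) (hb : NetModerate D k b)
    (ha' : NetSmooth D a) (hb' : NetSmooth D b) :
    NetModerate D k (fun ε z => B (a ε z) (b ε z)) := by
  induction k generalizing F G H with
  | zero =>
    intro p hp
    refine (((isModerate_const ‖B‖).mul (ha p hp)).mul (hb p hp)).mono (.of_forall fun ε => ?_)
    rw [abs_norm]
    exact (B.le_opNorm₂ _ _).trans (le_abs_self _)
  | succ k ih =>
    refine ⟨fun p hp => (ih B ha.of_succ hb.of_succ ha' hb').zero hp, ?_⟩
    -- Leibniz rule: each of the two terms is again bilinear, in a factor and a derivative.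
    refine NetModerate.congr hD (NetModerate.add hD
      (ih (B.precompR (EuclideanSpace ℝ (Fin n))) ha.of_succ hb.2 ha' hb'.fderiv_net)
      (ih (B.precompL (EuclideanSpace ℝ (Fin n))) ha.2 hb.of_succ ha'.fderiv_net hb')
      (ha'.bilinear _ hb'.fderiv_net) (ha'.fderiv_net.bilinear _ hb')) fun p hp => ?_
    filter_upwards [ha'.differentiableAt hp, hb'.differentiableAt hp] with ε h1 h2
    exact (B.hasFDerivAt_of_bilinear h1.hasFDerivAt h2.hasFDerivAt).fderiv

theorem NetSmooth.comp {N : ℕ} {D' : Set (Net N)} {g : Idx → EuclideanSpace ℝ (Fin n) →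
    EuclideanSpace ℝ (Fin N)} {h : Idx → EuclideanSpace ℝ (Fin N) → F} (hg : NetSmooth D g)
    (hh : NetSmooth D' h) (hmaps : ∀ p ∈ D, (fun ε => g ε (p ε)) ∈ D') :
    NetSmooth D (fun ε z => h ε (g ε z)) := fun p hp => by
  filter_upwards [hg p hp, hh _ (hmaps p hp)] with ε h1 h2
  exact ContDiffAt.comp (p ε) h2 h1

theorem NetModerate.comp (hD : IsOpenNets D) {N k : ℕ} {D' : Set (Net N)}
    {g : Idx → EuclideanSpace ℝ (Fin n) → EuclideanSpace ℝ (Fin N)}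
    {h : Idx → EuclideanSpace ℝ (Fin N) → F} (hg : NetModerate D k g) (hh : NetModerate D' k h)
    (hg' : NetSmooth D g) (hh' : NetSmooth D' h)
    (hmaps : ∀ p ∈ D, (fun ε => g ε (p ε)) ∈ D') :
    NetModerate D k (fun ε z => h ε (g ε z)) := by
  induction k generalizing F with
  | zero => exact fun p hp => hh _ (hmaps p hp)
  | succ k ih =>
    refine ⟨fun p hp => hh.zero (hmaps p hp), ?_⟩
    refine NetModerate.congr hD (NetModerate.bilinear hD (ContinuousLinearMap.compL ℝ _ _ _)
      (ih hg.of_succ hh.2 hh'.fderiv_net) hg.2 (hg'.comp hh'.fderiv_net hmaps) hg'.fderiv_net) fun p hp => ?_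
    filter_upwards [hg'.differentiableAt hp, hh'.differentiableAt (hmaps p hp)] with ε h1 h2
    exact (h2.hasFDerivAt.comp (p ε) h1.hasFDerivAt).fderiv

/-- The solution of a linear equation with moderate data whose operator is uniformly bounded below
is moderate. -/
theorem NetModerate.of_apply_eq (hD : IsOpenNets D) {k : ℕ}
    {a : Idx → EuclideanSpace ℝ (Fin n) → F →L[ℝ] G} {x : Idx → EuclideanSpace ℝ (Fin n) → F}
    {b : Idx → EuclideanSpace ℝ (Fin n) → G} (ha : NetModerate D k a) (hb : NetModerate D k b)
    (ha' : NetSmooth D a) (hb' : NetSmooth D b) (hx' : NetSmooth D x)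
    (heq : ∀ p ∈ D, ∀ᶠ ε in small, a ε (p ε) (x ε (p ε)) = b ε (p ε)) {C : ℝ} (hC : 0 ≤ C)
    (hlow : ∀ p ∈ D, ∀ᶠ ε in small, ∀ v, ‖v‖ ≤ C * ‖a ε (p ε) v‖) : NetModerate D k x := by
  have h0 : ∀ {F G : Type} [NormedAddCommGroup F] [NormedSpace ℝ F] [NormedAddCommGroup G]
      [NormedSpace ℝ G] {a : Idx → EuclideanSpace ℝ (Fin n) → F →L[ℝ] G}
      {x : Idx → EuclideanSpace ℝ (Fin n) → F} {b : Idx → EuclideanSpace ℝ (Fin n) → G},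
      (∀ p ∈ D, IsModerate (fun ε => ‖b ε (p ε)‖)) →
      (∀ p ∈ D, ∀ᶠ ε in small, a ε (p ε) (x ε (p ε)) = b ε (p ε)) →
      (∀ p ∈ D, ∀ᶠ ε in small, ∀ v, ‖v‖ ≤ C * ‖a ε (p ε) v‖) →
      ∀ p ∈ D, IsModerate (fun ε => ‖x ε (p ε)‖) := by
    intro F G _ _ _ _ a x b hb heq hlow p hp
    refine ((isModerate_const C).mul (hb p hp)).mono ?_
    filter_upwards [heq p hp, hlow p hp] with ε h1 h2
    rw [abs_norm, Pi.mul_apply, ← h1]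
    exact (h2 _).trans (le_abs_self _)
  induction k generalizing F G with
  | zero => exact h0 hb heq hlow
  | succ k ih =>
    refine ⟨h0 (fun p hp => hb.zero hp) heq hlow, ?_⟩
    have hx : NetModerate D k x := ih ha.of_succ hb.of_succ ha' hb' hx' heq hlow
    -- Differentiating `a x = b` gives `a ∘ Dx = Db - (Da) x`, an equation of the same kind for
    -- `Dx`. Its operator `S ↦ a ∘ S`, called `T a`, has the same lower bound `C`, and its
    -- right-hand side involves `x` only up to order `k`.
    obtain ⟨B, hB⟩ : ∃ B, B = (ContinuousLinearMap.id ℝ (F →L[ℝ] G)).precompL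
      (EuclideanSpace ℝ (Fin n)) := ⟨_, rfl⟩
    obtain ⟨L, hL⟩ : ∃ L, L = -ContinuousLinearMap.id ℝ (EuclideanSpace ℝ (Fin n) →L[ℝ] G) :=
      ⟨_, rfl⟩
    have hs : NetSmooth D fun ε z => B (fderiv ℝ (a ε) z) (x ε z) := ha'.fderiv_net.bilinear B hx'
    have hm : NetModerate D k fun ε z => B (fderiv ℝ (a ε) z) (x ε z) :=
      NetModerate.bilinear hD B ha.2 hx ha'.fderiv_net hx'
    obtain ⟨T, hT⟩ : ∃ T : (F →L[ℝ] G) →L[ℝ] (EuclideanSpace ℝ (Fin n) →L[ℝ] F) →L[ℝ]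
        EuclideanSpace ℝ (Fin n) →L[ℝ] G,
        T = ContinuousLinearMap.compL ℝ (EuclideanSpace ℝ (Fin n)) F G := ⟨_, rfl⟩
    have hsL : NetSmooth D fun ε z => L (B (fderiv ℝ (a ε) z) (x ε z)) := hs.clm L
    have hmL : NetModerate D k fun ε z => L (B (fderiv ℝ (a ε) z) (x ε z)) :=
      NetModerate.clm hD L hm hs
    have hs' : NetSmooth D fun ε z => fderiv ℝ (b ε) z + L (B (fderiv ℝ (a ε) z) (x ε z)) :=
      hb'.fderiv_net.add hsL
    have hm' : NetModerate D k fun ε z => fderiv ℝ (b ε) z + L (B (fderiv ℝ (a ε) z) (x ε z)) :=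
      NetModerate.add hD hb.2 hmL hb'.fderiv_net hsL
    have ht := NetSmooth.clm (G := (EuclideanSpace ℝ (Fin n) →L[ℝ] F) →L[ℝ]
      EuclideanSpace ℝ (Fin n) →L[ℝ] G) T ha'
    have ht' := NetModerate.clm (G := (EuclideanSpace ℝ (Fin n) →L[ℝ] F) →L[ℝ]
      EuclideanSpace ℝ (Fin n) →L[ℝ] G) hD T ha.of_succ ha'
    refine ih ht' hm' ht hs' hx'.fderiv_net (fun p hp => ?_) fun p hp => ?_
    · filter_upwards [hD.eventually_nhds (P := fun ε z => a ε z (x ε z) = b ε z) heq hp, ha'.differentiableAt hp,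
        hx'.differentiableAt hp] with ε h1 h2 h3
      have h4 := ((ContinuousLinearMap.id ℝ (F →L[ℝ] G)).hasFDerivAt_of_bilinear h2.hasFDerivAt
        h3.hasFDerivAt).fderiv
      have h5 : fderiv ℝ (b ε) (p ε) = _ := (Filter.EventuallyEq.fderiv_eq h1).symm.trans h4
      rw [h5]
      ext v
      simp [hB, hL, hT]
    · filter_upwards [hlow p hp] with ε h1 S
      refine S.opNorm_le_bound (by positivity) fun v => (h1 (S v)).trans ?_
      rw [mul_assoc, hT]
      exact mul_le_mul_of_nonneg_left
        ((ContinuousLinearMap.compL ℝ _ F G (a ε (p ε)) S).le_opNorm v) hC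

end NetCalculus

/-! ## Generalized maps represented by moderate smooth nets -/

/-- A mean value theorem for vector-valued maps. -/
theorem exists_norm_sub_le_norm_fderiv_apply {E F : Type*} [NormedAddCommGroup E]
    [NormedSpace ℝ E] [NormedAddCommGroup F] [NormedSpace ℝ F] {f : E → F} {x y : E}
    (h : ∀ z ∈ segment ℝ x y, DifferentiableAt ℝ f z) :
    ∃ z ∈ segment ℝ x y, ‖f y - f x‖ ≤ ‖fderiv ℝ f z (y - x)‖ := by
  -- A norming functional reduces the claim to the scalar mean value theorem along the segment.
  obtain ⟨g, hg, hgv⟩ := exists_dual_vector'' ℝ (f y - f x)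
  have hmem : ∀ t ∈ Set.Icc (0 : ℝ) 1, x + t • (y - x) ∈ segment ℝ x y := fun t ht => by
    rw [segment_eq_image']
    exact ⟨t, ht, rfl⟩
  have hder : ∀ t ∈ Set.Icc (0 : ℝ) 1, HasDerivAt (fun t : ℝ => g (f (x + t • (y - x))))
      (g (fderiv ℝ f (x + t • (y - x)) (y - x))) t := fun t ht => by
    have h1 : HasDerivAt (fun t : ℝ => x + t • (y - x)) (y - x) t := by
      simpa using ((hasDerivAt_id t).smul_const (y - x)).const_add x
    exact g.hasFDerivAt.comp_hasDerivAt t ((h _ (hmem t ht)).hasFDerivAt.comp_hasDerivAt t h1)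
  obtain ⟨t, ht, hslope⟩ := exists_hasDerivAt_eq_slope (fun t : ℝ => g (f (x + t • (y - x)))) _
    zero_lt_one (fun t ht => (hder t ht).continuousAt.continuousWithinAt)
    fun t ht => hder t (Set.Ioo_subset_Icc_self ht)
  refine ⟨_, hmem t (Set.Ioo_subset_Icc_self ht), ?_⟩
  have h2 : ‖f y - f x‖ = g (fderiv ℝ f (x + t • (y - x)) (y - x)) := by
    rw [hslope]
    simp only [one_smul, zero_smul, add_zero, sub_zero, div_one, add_sub_cancel, ← map_sub]
    exact hgv.symm
  rw [h2]
  refine (le_abs_self _).trans ((g.le_opNorm _).trans ?_)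
  exact mul_le_of_le_one_left (norm_nonneg _) hg

section Represented

variable {n : ℕ} {D : Set (Net n)} {F : Type} [NormedAddCommGroup F] [NormedSpace ℝ F]

/-- Otherwise points with values above `ε ^ (-m)`, found at every scale `m`, assemble into a net of
`D` along which `h` is not moderate. -/
theorem IsOpenNets.exists_norm_le {F : Type*} [NormedAddCommGroup F] (hD : IsOpenNets D)
    {h : Idx → EuclideanSpace ℝ (Fin n) → F}
    (hh : ∀ p ∈ D, IsModerate (fun ε => ‖h ε (p ε)‖)) {p : Net n} (hp : p ∈ D) :
    ∃ m : ℕ, ∀ᶠ ε : Idx in small, ∀ z, ‖z - p ε‖ < (ε : ℝ) ^ m →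
      ‖h ε z‖ ≤ (ε : ℝ) ^ (-(m : ℝ)) := by
  by_contra hc
  push Not at hc
  obtain ⟨q, h1, -, h2⟩ := exists_net_of_frequently p
    (Q := fun m ε z => (ε : ℝ) ^ (-(m : ℝ)) < ‖h ε z‖) hc
  obtain ⟨m, hm⟩ := hD p hp
  obtain ⟨k, hk⟩ := (hh q (hm q (by simpa using h1 m))).exists_nat
  obtain ⟨ε, ⟨j, hj, h3⟩, h4⟩ := ((h2 k).and_eventually hk).exists
  rw [abs_norm] at h4
  have := ε.rpow_anti (r := -(j : ℝ)) (s := -(k : ℝ)) (by simpa using hj)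
  linarith

theorem norm_sub_lt_of_mem_segment {E : Type*} [NormedAddCommGroup E] [NormedSpace ℝ E]
    {x y z : E} {ρ : ℝ} (hy : ‖y - x‖ < ρ) (hz : z ∈ segment ℝ x y) : ‖z - x‖ < ρ :=
  lt_of_le_of_lt (norm_sub_le_of_mem_segment hz) hy

theorem Idx.pow_anti (ε : Idx) {m k : ℕ} (h : m ≤ k) : (ε : ℝ) ^ k ≤ (ε : ℝ) ^ m :=
  pow_le_pow_of_le_one ε.2.1.le ε.2.2 h

theorem NetSmooth.exists_lipschitz (hD : IsOpenNets D) {h : Idx → EuclideanSpace ℝ (Fin n) → F}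
    (hs : NetSmooth D h) (hm : NetModerate D 1 h) {p : Net n} (hp : p ∈ D) :
    ∃ m : ℕ, ∀ᶠ ε : Idx in small, ∀ z, ‖z - p ε‖ < (ε : ℝ) ^ m →
      ‖h ε z - h ε (p ε)‖ ≤ (ε : ℝ) ^ (-(m : ℝ)) * ‖z - p ε‖ := by
  obtain ⟨m₁, h1⟩ := hD.exists_pow (P := fun ε z => DifferentiableAt ℝ (h ε) z)
    (fun p hp => hs.differentiableAt hp) hp
  obtain ⟨m₂, h2⟩ := hD.exists_norm_le hm.2 hp
  refine ⟨max m₁ m₂, ?_⟩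
  filter_upwards [h1, h2] with ε h1 h2 z hz
  have hz1 := hz.trans_le (ε.pow_anti (le_max_left m₁ m₂))
  have hz2 := hz.trans_le (ε.pow_anti (le_max_right m₁ m₂))
  obtain ⟨w, hw, h3⟩ := exists_norm_sub_le_norm_fderiv_apply (f := h ε) (x := p ε) (y := z)
    fun w hw => h1 w (norm_sub_lt_of_mem_segment hz1 hw)
  refine h3.trans (((fderiv ℝ (h ε) w).le_opNorm _).trans ?_)
  refine mul_le_mul_of_nonneg_right ?_ (norm_nonneg _)
  refine (h2 w (norm_sub_lt_of_mem_segment hz2 hw)).trans (ε.rpow_anti ?_)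
  simp

theorem NetSmooth.exists_taylor (hD : IsOpenNets D) {h : Idx → EuclideanSpace ℝ (Fin n) → F}
    (hs : NetSmooth D h) (hm : NetModerate D 2 h) {p : Net n} (hp : p ∈ D) :
    ∃ m : ℕ, ∀ᶠ ε : Idx in small, ∀ z, ‖z - p ε‖ < (ε : ℝ) ^ m →
      ‖h ε z - h ε (p ε) - fderiv ℝ (h ε) (p ε) (z - p ε)‖ ≤
        (ε : ℝ) ^ (-(m : ℝ)) * ‖z - p ε‖ * ‖z - p ε‖ := by
  obtain ⟨m₁, h1⟩ := hD.exists_pow (P := fun ε z => DifferentiableAt ℝ (h ε) z)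
    (fun p hp => hs.differentiableAt hp) hp
  obtain ⟨m₂, h2⟩ := hs.fderiv_net.exists_lipschitz hD hm.2 hp
  refine ⟨max m₁ m₂, ?_⟩
  filter_upwards [h1, h2] with ε h1 h2 z hz
  have hz1 := hz.trans_le (ε.pow_anti (le_max_left m₁ m₂))
  have hz2 := hz.trans_le (ε.pow_anti (le_max_right m₁ m₂))
  set L := fderiv ℝ (h ε) (p ε)
  -- Subtracting the linear part leaves a map whose derivative is controlled by the Lipschitz bound
  -- for `fderiv ℝ (h ε)`.
  have hder : ∀ w ∈ segment ℝ (p ε) z, HasFDerivAt (fun w => h ε w - L w)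
      (fderiv ℝ (h ε) w - L) w := fun w hw =>
    (h1 w (norm_sub_lt_of_mem_segment hz1 hw)).hasFDerivAt.sub L.hasFDerivAt
  obtain ⟨w, hw, h3⟩ := exists_norm_sub_le_norm_fderiv_apply fun w hw =>
    (hder w hw).differentiableAt
  rw [(hder w hw).fderiv] at h3
  have e : h ε z - h ε (p ε) - L (z - p ε) = h ε z - L z - (h ε (p ε) - L (p ε)) := by
    rw [map_sub]
    abel
  rw [e]
  refine h3.trans (((fderiv ℝ (h ε) w - L).le_opNorm _).trans ?_)
  refine mul_le_mul_of_nonneg_right ?_ (norm_nonneg _)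
  refine (h2 w (norm_sub_lt_of_mem_segment hz2 hw)).trans ?_
  refine mul_le_mul (ε.rpow_anti (by simp)) (norm_sub_le_of_mem_segment hw) (norm_nonneg _)
    (ε.rpow_pos _).le

theorem NetSmooth.isNegligible_sub (hD : IsOpenNets D)
    {h : Idx → EuclideanSpace ℝ (Fin n) → F} (hs : NetSmooth D h) (hm : NetModerate D 1 h)
    {p q : Net n} (hp : p ∈ D) (hq : IsNegligible (fun ε => ‖q ε - p ε‖)) :
    IsNegligible (fun ε => ‖h ε (q ε) - h ε (p ε)‖) := by
  obtain ⟨m, h1⟩ := hs.exists_lipschitz hD hm hp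
  refine ((isModerate_inv_pow m).mul_isNegligible hq).mono ?_
  filter_upwards [h1, hq m] with ε h1 h2
  rw [abs_norm] at h2 ⊢
  have h3 := h1 _ h2
  rw [Real.rpow_neg ε.2.1.le, Real.rpow_natCast] at h3
  exact h3.trans (le_abs_self _)

/-- A moderate net of linear maps induces a linear map of generalized points. -/
theorem exists_linearMap_of_isModerate {m : ℕ}
    {a : Idx → EuclideanSpace ℝ (Fin n) →L[ℝ] EuclideanSpace ℝ (Fin m)}
    (ha : IsModerate (fun ε => ‖a ε‖)) :
    ∃ L : GenVec n →ₗ[GenReal] GenVec m, ∀ (w : Net n) (v : GenVec n), IsRep w v →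
      IsRep (fun ε => a ε (w ε)) (L v) := by
  have h1 : ∀ j i, IsModerate (fun ε => a ε (EuclideanSpace.single j 1) i) := fun j =>
    (isModerate_norm_iff (p := fun ε => a ε (EuclideanSpace.single j 1))).1 (ha.mono
      (.of_forall fun ε => by
        rw [abs_norm, abs_norm]
        simpa using (a ε).le_opNorm (EuclideanSpace.single j 1)))
  refine ⟨Matrix.mulVecLin (fun i j => GenReal.mk ⟨_, h1 j i⟩), fun w v hw i => ?_⟩
  choose h2 e using hw
  have e1 : (fun ε => a ε (w ε) i) =
      ((∑ j, (⟨_, h1 j i⟩ : moderateNets) * ⟨_, h2 j⟩ : moderateNets) : Idx → ℝ) := by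
    ext ε
    have hw : w ε = ∑ j, w ε j • EuclideanSpace.single j (1 : ℝ) := by
      ext i
      simp [Finset.sum_apply, Pi.single_apply]
    conv_lhs => rw [hw]
    simp [mul_comm]
  refine ⟨by rw [e1]; exact SetLike.coe_mem _, ?_⟩
  have e2 : GenReal.mk (∑ j, (⟨_, h1 j i⟩ : moderateNets) * ⟨_, h2 j⟩) =
      ∑ j, GenReal.mk ⟨_, h1 j i⟩ * GenReal.mk ⟨_, h2 j⟩ := by
    exact map_sum (Ideal.Quotient.mk negligibleNets) _ _
  change ∑ j, _ * v j = _
  rw [Finset.sum_congr rfl fun j _ => by rw [e j], ← e2]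
  congr 1
  exact Subtype.ext e1.symm

theorem isRep_single (j : Fin n) :
    IsRep (fun _ => EuclideanSpace.single j (1 : ℝ)) (Pi.single j (1 : GenReal)) := fun i => by
  refine ⟨isModerate_const _, ?_⟩
  by_cases hij : i = j
  · subst hij
    rw [Pi.single_eq_same]
    refine congrArg GenReal.mk (a₁ := 1) (Subtype.ext (funext fun ε => ?_))
    simp
  · rw [Pi.single_eq_of_ne hij]
    refine congrArg GenReal.mk (a₁ := 0) (Subtype.ext (funext fun ε => ?_))
    simp [hij]

/-- The nets representing the points of `S`. -/
def repNets (S : Set (GenVec n)) : Set (Net n) := {p | ∃ x ∈ S, IsRep p x}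

theorem isOpenNets_repNets {S : Set (GenVec n)} (hS : IsOpen S) : IsOpenNets (repNets S) := by
  rintro p ⟨x, hx, hp⟩
  obtain ⟨δ, hδ, h⟩ := isOpen_sharp_iff.1 hS x hx
  -- This makes `e ^ (-m) < δ`, so a tube of width `ε ^ m` stays in the sharp ball.
  obtain ⟨m, hm⟩ := exists_nat_gt (-Real.log δ)
  refine ⟨m, fun q hq => ?_⟩
  obtain ⟨w, hw⟩ := exists_isRep_of_isModerate (p := fun ε => q ε - p ε)
    ⟨m, by simpa using hq⟩
  refine ⟨w + x, h _ ?_, by simpa using hw.add hp⟩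
  rw [add_sub_cancel_right]
  refine (sharpNorm_le hw (r := m) (by simpa using hq)).trans_lt ?_
  rw [← Real.lt_log_iff_exp_lt hδ]
  linarith

/-- A map represented by a moderate smooth net is smooth in the generalized sense. -/
theorem genContDiffOn_of_isRep {m : ℕ} {S : Set (GenVec n)} (hS : IsOpen S)
    {h : Idx → EuclideanSpace ℝ (Fin n) → EuclideanSpace ℝ (Fin m)} {f : GenVec n → GenVec m}
    (hs : NetSmooth (repNets S) h) (hm : ∀ k, NetModerate (repNets S) k h)
    (hf : ∀ x ∈ S, ∀ p, IsRep p x → IsRep (fun ε => h ε (p ε)) (f x)) (k : ℕ) :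
    GenContDiffOn k f S := by
  have hD := isOpenNets_repNets hS
  induction k generalizing h f with
  | zero =>
    refine continuousOn_of_sharpNorm fun x hx δ hδ => ?_
    obtain ⟨p, hp⟩ := exists_isRep x
    obtain ⟨m, h1⟩ := hs.exists_lipschitz hD (hm 1) ⟨x, hx, hp⟩
    -- A Lipschitz constant `ε ^ (-m)` multiplies sharp norms by at most `e ^ m`.
    refine ⟨min (Real.exp (-(m : ℝ))) (δ * Real.exp (-(m : ℝ))), by positivity,
      fun y hy hyx => ?_⟩
    obtain ⟨q, hq⟩ := exists_isRep y
    have h2 := sharpNorm_le_mul (s := -(m : ℝ)) (c := fun ε => (ε : ℝ) ^ (-(m : ℝ)))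
      ((hf y hy q hq).sub (hf x hx p hp)) (hq.sub hp)
      (fun t ht => .of_forall fun ε => ε.rpow_anti ht.le) (by
        filter_upwards [h1, eventually_norm_sub_lt_of_sharpNorm hq hp
          (hyx.trans_le (min_le_left _ _))] with ε h1 h2 using h1 _ h2)
    refine h2.trans_lt ?_
    rw [neg_neg]
    have h3 := hyx.trans_le (min_le_right _ _)
    rwa [Real.exp_neg, ← div_eq_mul_inv, lt_div_iff₀' (Real.exp_pos _)] at h3
  | succ k ih =>
    have hL : ∀ x, ∃ L : GenVec n →ₗ[GenReal] GenVec m, x ∈ S → ∀ p, IsRep p x →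
        ∀ w v, IsRep w v → IsRep (fun ε => fderiv ℝ (h ε) (p ε) (w ε)) (L v) := by
      intro x
      by_cases hx : x ∈ S
      · obtain ⟨p, hp⟩ := exists_isRep x
        obtain ⟨L, hL⟩ := exists_linearMap_of_isModerate ((hm 1).2 p ⟨x, hx, hp⟩)
        refine ⟨L, fun _ q hq w v hw => (hL w v hw).of_isNegligible_sub ?_⟩
        refine (hw.isModerate.mul_isNegligible (hs.fderiv_net.isNegligible_sub hD (hm 2).2
          ⟨x, hx, hp⟩ (hq.isNegligible_sub hp))).mono (.of_forall fun ε => ?_)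
        rw [abs_norm, Pi.mul_apply, mul_comm]
        exact ((fderiv ℝ (h ε) (q ε) - fderiv ℝ (h ε) (p ε)).le_opNorm _).trans (le_abs_self _)
      · exact ⟨0, fun h => absurd h hx⟩
    choose f' hf' using hL
    refine ⟨f', fun x hx δ hδ => ?_, fun j => ?_⟩
    · obtain ⟨p, hp⟩ := exists_isRep x
      obtain ⟨m, h1⟩ := hs.exists_taylor hD (hm 2) ⟨x, hx, hp⟩
      -- The Taylor remainder carries the factor `ε ^ (-m) * ‖q ε - p ε‖`, below `ε ^ (s - m)`, and
      -- `e ^ (-(s - m)) = δ`.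
      set s : ℝ := m - Real.log δ
      refine ⟨min (Real.exp (-(m : ℝ))) (Real.exp (-s)), by positivity, fun y hy hyx => ?_⟩
      obtain ⟨q, hq⟩ := exists_isRep y
      have hrep := ((hf y hy q hq).sub (hf x hx p hp)).sub (hf' x hx p hp _ _ (hq.sub hp))
      have h2 := sharpNorm_le_mul (s := s - m)
        (c := fun ε => (ε : ℝ) ^ (-(m : ℝ)) * ‖q ε - p ε‖) hrep (hq.sub hp)
        (fun t ht => by
          filter_upwards [(hq.sub hp).eventually_norm_lt (hyx.trans_le (min_le_right _ _))]
            with ε h3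
          calc (ε : ℝ) ^ (-(m : ℝ)) * ‖q ε - p ε‖ ≤ (ε : ℝ) ^ (-(m : ℝ)) * (ε : ℝ) ^ s :=
                mul_le_mul_of_nonneg_left h3.le (ε.rpow_pos _).le
            _ = (ε : ℝ) ^ (s - m) := by rw [← Real.rpow_add ε.2.1]; congr 1; ring
            _ ≤ (ε : ℝ) ^ t := ε.rpow_anti ht.le)
        (by
          filter_upwards [h1, eventually_norm_sub_lt_of_sharpNorm hq hp
            (hyx.trans_le (min_le_left _ _))] with ε h1 h2 using h1 _ h2)
      have e : Real.exp (-(s - m)) = δ := by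
        rw [show -(s - m) = Real.log δ by simp [s], Real.exp_log hδ]
      rwa [e] at h2
    · let L : (EuclideanSpace ℝ (Fin n) →L[ℝ] EuclideanSpace ℝ (Fin m)) →L[ℝ]
          EuclideanSpace ℝ (Fin m) :=
        ContinuousLinearMap.apply ℝ _ (EuclideanSpace.single j (1 : ℝ))
      -- The `j`-th partial derivative is represented by the net of classical partial derivatives,
      -- so the induction applies.
      exact ih (hs.fderiv_net.clm L) (fun k => NetModerate.clm hD L (hm (k + 1)).2 hs.fderiv_net)
        fun x hx p hp => hf' x hx p hp _ _ (isRep_single j)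

end Represented

/-! ## Changes of charts -/

theorem norm_le_norm_fderiv_of_norm_sub_le {E F : Type*} [NormedAddCommGroup E] [NormedSpace ℝ E]
    [NormedAddCommGroup F] [NormedSpace ℝ F] {f : E → F} {x : E} (hf : DifferentiableAt ℝ f x)
    {C : ℝ} (h : ∀ᶠ y in 𝓝 x, ‖y - x‖ ≤ C * ‖f y - f x‖) (v : E) : ‖v‖ ≤ C * ‖fderiv ℝ f x v‖ := by
  have hlim := (hf.hasFDerivAt.lim_real v).norm.const_mul C
  refine ge_of_tendsto hlim ?_
  have h1 : Filter.Tendsto (fun c : ℝ => x + c⁻¹ • v) Filter.atTop (𝓝 x) := by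
    simpa using ((tendsto_inv_atTop_zero (𝕜 := ℝ)).smul_const v).const_add x
  filter_upwards [h1.eventually h, Filter.eventually_gt_atTop 0] with c h2 hc
  rw [add_sub_cancel_left, norm_smul, Real.norm_of_nonneg (inv_pos.2 hc).le] at h2
  rw [norm_smul, Real.norm_of_nonneg hc.le]
  rw [inv_mul_le_iff₀ hc] at h2
  linarith

theorem IsModerate.of_forall_le_pow {x : Idx → ℝ} {m : ℕ} {C : ℝ}
    (h : ∀ᶠ ε : Idx in small, |x ε| ≤ C * ((ε : ℝ) ^ m)⁻¹) : IsModerate x :=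
  ((isModerate_const C).mul (isModerate_inv_pow m)).mono
    (h.mono fun _ h => h.trans (le_abs_self _))

/-- Were `p ε` closer to the sphere, rescaling it radially to norm `r` would leave the ball inside
the tube granted by strong internality. -/
theorem exists_inv_sub_norm_le {n : ℕ} {r : ℝ} (hr : 0 < r) {x : GenVec n}
    (hx : x ∈ stronglyInternal Set.univ (fun _ => Metric.ball (0 : EuclideanSpace ℝ (Fin n)) r))
    {p : Net n} (hp : IsRep p x) :
    ∃ m : ℕ, ∀ᶠ ε : Idx in small, (r - ‖p ε‖)⁻¹ ≤ ((ε : ℝ) ^ m)⁻¹ := by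
  obtain ⟨m, hm⟩ := exists_pow_of_mem_stronglyInternal hx hp (.of_forall fun _ => trivial)
  refine ⟨m + 1, ?_⟩
  filter_upwards [hm, eventually_pow_succ_lt hr m,
    hx.2 p hp (.of_forall fun _ => trivial)] with ε h1 h2 h3
  rw [mem_ball_zero_iff] at h3
  have h4 := pow_pos ε.2.1 (m + 1)
  refine inv_anti₀ h4 (not_lt.1 fun h5 => ?_)
  have h6 : 0 < ‖p ε‖ := by linarith
  have h7 := h1 ((r / ‖p ε‖) • p ε) trivial (by
    have e : (r / ‖p ε‖) • p ε - p ε = ((r - ‖p ε‖) / ‖p ε‖) • p ε := by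
      rw [sub_div, div_self h6.ne', sub_smul, one_smul]
    rw [e, norm_smul, Real.norm_of_nonneg (div_nonneg (by linarith) h6.le),
      div_mul_cancel₀ _ h6.ne']
    exact h5.trans_le (ε.pow_anti (Nat.le_succ m)))
  rw [mem_ball_zero_iff, norm_smul, Real.norm_of_nonneg (by positivity),
    div_mul_cancel₀ _ h6.ne'] at h7
  exact lt_irrefl _ h7

namespace SubmanifoldAtlas

variable {N n : ℕ} {M : Set (EuclideanSpace ℝ (Fin N))} {r : ℝ} {Λ : Type*}
  {A : SubmanifoldAtlas M n r Λ}

theorem contDiffAt_symm (A : SubmanifoldAtlas M n r Λ) {α : Λ} {x : EuclideanSpace ℝ (Fin n)}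
    (hx : x ∈ Metric.ball 0 r) : ContDiffAt ℝ ∞ (A.chart α).symm x :=
  (A.smooth_symm α).contDiffAt (Metric.isOpen_ball.mem_nhds hx)

/-- If `B` is a linear left inverse of the derivative of `φ_β⁻¹` at `y`, then `B ∘ φ_β⁻¹` has
identity derivative there and is locally invertible. Near `x` the transition is this local inverse
composed with `B ∘ φ_α⁻¹`; only continuity of `φ_β` is used. -/
theorem contDiffAt_transition (A : SubmanifoldAtlas M n r Λ) {α β : Λ}
    {x : EuclideanSpace ℝ (Fin n)} (hx : x ∈ Metric.ball 0 r)
    (hxβ : (A.chart α).symm x ∈ (A.chart β).source) :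
    ContDiffAt ℝ ∞ (fun z => A.chart β ((A.chart α).symm z)) x := by
  set y := A.chart β ((A.chart α).symm x) with hy
  have hyb := A.chart_mem_ball hxβ
  have hsy := A.contDiffAt_symm (α := β) hyb
  obtain ⟨B₀, hB₀⟩ := LinearMap.exists_leftInverse_of_injective
    (fderiv ℝ (A.chart β).symm y : EuclideanSpace ℝ (Fin n) →ₗ[ℝ] EuclideanSpace ℝ (Fin N))
    (LinearMap.ker_eq_bot.2 (A.immersion β y hyb))
  let B : EuclideanSpace ℝ (Fin N) →L[ℝ] EuclideanSpace ℝ (Fin n) :=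
    LinearMap.toContinuousLinearMap B₀
  have hu : ContDiffAt ℝ ∞ (fun z => B ((A.chart β).symm z)) y :=
    B.contDiff.contDiffAt.comp y hsy
  have hu' : HasFDerivAt (fun z => B ((A.chart β).symm z))
      ((ContinuousLinearEquiv.refl ℝ (EuclideanSpace ℝ (Fin n)) :
        EuclideanSpace ℝ (Fin n) →L[ℝ] EuclideanSpace ℝ (Fin n))) y := by
    have e : ((ContinuousLinearEquiv.refl ℝ (EuclideanSpace ℝ (Fin n)) :
        EuclideanSpace ℝ (Fin n) →L[ℝ] EuclideanSpace ℝ (Fin n))) =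
        B.comp (fderiv ℝ (A.chart β).symm y) :=
      ContinuousLinearMap.ext fun v => (LinearMap.congr_fun hB₀ v).symm
    rw [e]
    exact B.hasFDerivAt.comp y (hsy.differentiableAt (by simp)).hasFDerivAt
  have hne : (∞ : WithTop ℕ∞) ≠ 0 := by simp
  have hinv := hu.to_localInverse hu' hne
  have hleft := (hu.hasStrictFDerivAt' hu' hne).eventually_left_inverse
  have hsrc : ∀ᶠ z in 𝓝 x, (A.chart α).symm z ∈ (A.chart β).source := by
    obtain ⟨O, hO, e⟩ := A.source_open β
    rw [e] at hxβ
    filter_upwards [(A.contDiffAt_symm (α := α) hx).continuousAt (hO.mem_nhds hxβ.2),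
      Metric.isOpen_ball.mem_nhds hx] with z h1 h2
    rw [e]
    exact ⟨A.source_subset α (A.symm_mem_source h2), h1⟩
  have hcont : Filter.Tendsto (fun z => A.chart β ((A.chart α).symm z)) (𝓝 x) (𝓝 y) :=
    (A.continuousOn_chart β _ hxβ).tendsto.comp (tendsto_nhdsWithin_iff.2
      ⟨(A.contDiffAt_symm (α := α) hx).continuousAt, hsrc⟩)
  have hcomp : ContDiffAt ℝ ∞ (fun z => hu.localInverse hu' hne (B ((A.chart α).symm z))) x := by
    have e : B ((A.chart α).symm x) = B ((A.chart β).symm y) := by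
      rw [hy, A.symm_chart_apply hxβ]
    refine ContDiffAt.comp x (g := hu.localInverse hu' hne)
      (f := fun z => B ((A.chart α).symm z)) ?_
      (B.contDiff.contDiffAt.comp x (A.contDiffAt_symm (α := α) hx))
    rw [e]
    exact hinv
  refine hcomp.congr_of_eventuallyEq ?_
  filter_upwards [hsrc, hcont.eventually hleft] with z h1 h2
  rw [A.symm_chart_apply h1] at h2
  exact h2.symm

theorem isRep_symm_genChart (hr : 0 < r) (hLip : A.IsBiLipschitz) {l : Idx → Λ}
    (hl : (Set.range l).Finite) {x : GenVec N} (hx : x ∈ A.genDomain l) {p : Net n}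
    (hp : IsRep p (A.genChart l x)) :
    (∀ᶠ ε in small, p ε ∈ Metric.ball 0 r) ∧ IsRep (fun ε => (A.chart (l ε)).symm (p ε)) x := by
  have hpb := (mapsTo_genChart hr hLip hl hx).2 p hp (.of_forall fun _ => trivial)
  refine ⟨hpb, ?_⟩
  obtain ⟨C, -, hC⟩ := hLip.exists_forall_norm_le hl
  obtain ⟨q, hq, hqM⟩ := exists_isRep_of_mem_compactPoints hx.1
  refine hq.of_isNegligible_sub (((isModerate_const C).mul_isNegligible
    (hp.isNegligible_sub (isRep_genChart hLip hl hx hq hqM))).mono ?_)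
  filter_upwards [hpb, hx.2 q hq hqM] with ε h1 h2
  have h3 := (hC ε).2 _ h1 _ (A.chart_mem_ball h2)
  rw [A.symm_chart_apply h2] at h3
  rw [abs_norm]
  exact h3.trans (le_abs_self _)

theorem HasModerateGrowth.netModerate {l : Idx → Λ} (hl : (Set.range l).Finite)
    (hg : ∀ ε, A.HasModerateGrowth (l ε)) {D : Set (Net n)}
    (hD : ∀ p ∈ D, (∀ᶠ ε in small, p ε ∈ Metric.ball 0 r) ∧
      ∃ m : ℕ, ∀ᶠ ε : Idx in small, (r - ‖p ε‖)⁻¹ ≤ ((ε : ℝ) ^ m)⁻¹) (k : ℕ) :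
    NetModerate D k (fun ε => (A.chart (l ε)).symm) := by
  refine NetModerate.of_iteratedFDeriv (fun j p hp => ?_) k
  have hg' : ∀ α ∈ Set.range l, ∃ (C : ℝ) (m : ℕ), ∀ x ∈ Metric.ball 0 r,
      ‖iteratedFDeriv ℝ j (A.chart α).symm x‖ ≤ C * ((r - ‖x‖)⁻¹) ^ m := by
    rintro _ ⟨ε, rfl⟩
    exact hg ε j
  choose! C m hCm using hg'
  obtain ⟨E, hE0, hE⟩ := hl.exists_forall_comp_le C
  obtain ⟨K, hK⟩ := (hl.image m).bddAbove
  obtain ⟨hpb, s, hs⟩ := hD p hp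
  -- The inverse distance to the sphere is at most `ε ^ (-s)`, raised to a growth exponent of at
  -- most `K` over the finite range.
  refine IsModerate.of_forall_le_pow (m := s * K) (C := E) ?_
  filter_upwards [hpb, hs] with ε h1 h2
  rw [abs_norm]
  have h3 : 0 ≤ (r - ‖p ε‖)⁻¹ := inv_nonneg.2 (sub_nonneg.2 (mem_ball_zero_iff.1 h1).le)
  have h4 : 1 ≤ ((ε : ℝ) ^ s)⁻¹ :=
    (one_le_inv₀ (pow_pos ε.2.1 s)).2 (pow_le_one₀ ε.2.1.le ε.2.2)
  refine (hCm (l ε) ⟨ε, rfl⟩ _ h1).trans ?_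
  refine mul_le_mul (hE ε) ?_ (pow_nonneg h3 _) hE0.le
  rw [pow_mul, ← inv_pow]
  exact (pow_le_pow_left₀ h3 h2 _).trans (pow_le_pow_right₀ h4 (hK ⟨l ε, ⟨ε, rfl⟩, rfl⟩))

theorem isOpen_genChart_image_inter (hr : 0 < r) (hLip : A.IsBiLipschitz) {l₁ l₂ : Idx → Λ}
    (hl₁ : (Set.range l₁).Finite) :
    IsOpen (A.genChart l₁ '' (A.genDomain l₁ ∩ A.genDomain l₂)) := by
  rw [← isOpen_genChart_image_iff hr hLip hl₁ Set.inter_subset_left, Set.preimage_inter]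
  exact (A.isOpen_preimage_genDomain l₁).inter (A.isOpen_preimage_genDomain l₂)

/-- A change of charts is smooth in the generalized sense. -/
theorem genContDiffOn_change (hr : 0 < r) (hLip : A.IsBiLipschitz) {l₁ l₂ : Idx → Λ}
    (hl₁ : (Set.range l₁).Finite) (hl₂ : (Set.range l₂).Finite)
    (hg₁ : ∀ ε, A.HasModerateGrowth (l₁ ε)) (hg₂ : ∀ ε, A.HasModerateGrowth (l₂ ε))
    {f : GenVec n → GenVec n}
    (hf : ∀ x ∈ A.genDomain l₁ ∩ A.genDomain l₂, f (A.genChart l₁ x) = A.genChart l₂ x) (k : ℕ) :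
    GenContDiffOn k f (A.genChart l₁ '' (A.genDomain l₁ ∩ A.genDomain l₂)) := by
  set S₁ := A.genChart l₁ '' (A.genDomain l₁ ∩ A.genDomain l₂)
  set S₂ := A.genChart l₂ '' (A.genDomain l₁ ∩ A.genDomain l₂)
  have hS₁ : IsOpen S₁ := isOpen_genChart_image_inter hr hLip hl₁
  set D₁ := repNets S₁
  set D₂ := repNets S₂
  have hD₁ : IsOpenNets D₁ := isOpenNets_repNets hS₁
  obtain ⟨C, hC0, hC⟩ := hLip.exists_forall_norm_le hl₂
  let g : Idx → EuclideanSpace ℝ (Fin n) → EuclideanSpace ℝ (Fin n) :=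
    fun ε z => A.chart (l₂ ε) ((A.chart (l₁ ε)).symm z)
  have hgrep : ∀ x ∈ A.genDomain l₁ ∩ A.genDomain l₂, ∀ p, IsRep p (A.genChart l₁ x) →
      (∀ᶠ ε in small, p ε ∈ Metric.ball 0 r) ∧
      (∀ᶠ ε in small, (A.chart (l₁ ε)).symm (p ε) ∈ (A.chart (l₂ ε)).source) ∧
      IsRep (fun ε => g ε (p ε)) (A.genChart l₂ x) := by
    intro x hx p hp
    obtain ⟨h1, h2⟩ := isRep_symm_genChart hr hLip hl₁ hx.1 hp
    have h3 := h1.mono fun ε h => A.source_subset (l₁ ε) (A.symm_mem_source h)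
    exact ⟨h1, hx.2.2 _ h2 h3, isRep_genChart hLip hl₂ hx.2 h2 h3⟩
  have hb₁ : ∀ p ∈ D₁, (∀ᶠ ε in small, p ε ∈ Metric.ball 0 r) ∧
      ∀ᶠ ε in small, (A.chart (l₁ ε)).symm (p ε) ∈ (A.chart (l₂ ε)).source := by
    rintro p ⟨_, ⟨x, hx, rfl⟩, hp⟩
    exact ⟨(hgrep x hx p hp).1, (hgrep x hx p hp).2.1⟩
  have hmaps : ∀ p ∈ D₁, (fun ε => g ε (p ε)) ∈ D₂ := by
    rintro p ⟨_, ⟨x, hx, rfl⟩, hp⟩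
    exact ⟨_, ⟨x, hx, rfl⟩, (hgrep x hx p hp).2.2⟩
  have hb₂ : ∀ p ∈ D₂, ∀ᶠ ε in small, p ε ∈ Metric.ball 0 r := by
    rintro p ⟨_, ⟨x, hx, rfl⟩, hp⟩
    exact (isRep_symm_genChart hr hLip hl₂ hx.2 hp).1
  have hm₁ : ∀ k, NetModerate D₁ k (fun ε => (A.chart (l₁ ε)).symm) :=
    HasModerateGrowth.netModerate hl₁ hg₁ fun p hp => ⟨(hb₁ p hp).1, by
      obtain ⟨_, ⟨x, hx, rfl⟩, hp⟩ := hp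
      exact exists_inv_sub_norm_le hr (mapsTo_genChart hr hLip hl₁ hx.1) hp⟩
  have hm₂ : ∀ k, NetModerate D₂ k (fun ε => (A.chart (l₂ ε)).symm) :=
    HasModerateGrowth.netModerate hl₂ hg₂ fun p hp => ⟨hb₂ p hp, by
      obtain ⟨_, ⟨x, hx, rfl⟩, hp⟩ := hp
      exact exists_inv_sub_norm_le hr (mapsTo_genChart hr hLip hl₂ hx.2) hp⟩
  have hs₁ : NetSmooth D₁ (fun ε => (A.chart (l₁ ε)).symm) := fun p hp =>
    (hb₁ p hp).1.mono fun ε h => A.contDiffAt_symm h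
  have hs₂ : NetSmooth D₂ (fun ε => (A.chart (l₂ ε)).symm) := fun p hp =>
    (hb₂ p hp).mono fun ε h => A.contDiffAt_symm h
  have hsg : NetSmooth D₁ g := fun p hp => by
    filter_upwards [(hb₁ p hp).1, (hb₁ p hp).2] with ε h1 h2 using A.contDiffAt_transition h1 h2
  obtain ⟨T, hT⟩ : ∃ T : (EuclideanSpace ℝ (Fin n) →L[ℝ] EuclideanSpace ℝ (Fin N)) →L[ℝ]
      (EuclideanSpace ℝ (Fin n) →L[ℝ] EuclideanSpace ℝ (Fin n)) →L[ℝ]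
        EuclideanSpace ℝ (Fin n) →L[ℝ] EuclideanSpace ℝ (Fin N),
      ∀ a b, T a b = a.comp b := ⟨ContinuousLinearMap.compL ℝ _ _ _, fun _ _ => rfl⟩
  have hsE := hsg.comp hs₂.fderiv_net hmaps
  have hsT := NetSmooth.clm
    (G := (EuclideanSpace ℝ (Fin n) →L[ℝ] EuclideanSpace ℝ (Fin n)) →L[ℝ]
      EuclideanSpace ℝ (Fin n) →L[ℝ] EuclideanSpace ℝ (Fin N)) T hsE
  have heq : ∀ p ∈ D₁, ∀ᶠ ε in small, T (fderiv ℝ (A.chart (l₂ ε)).symm (g ε (p ε)))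
      (fderiv ℝ (g ε) (p ε)) = fderiv ℝ (A.chart (l₁ ε)).symm (p ε) := fun p hp => by
    have h0 := hD₁.eventually_nhds
      (P := fun ε z => (A.chart (l₂ ε)).symm (g ε z) = (A.chart (l₁ ε)).symm z)
      (fun p hp => (hb₁ p hp).2.mono fun ε h => A.symm_chart_apply h) hp
    filter_upwards [h0, hsg.differentiableAt hp, hs₂.differentiableAt (hmaps p hp)]
      with ε h1 h2 h3
    have h4 := (h3.hasFDerivAt.comp (p ε) h2.hasFDerivAt).fderiv
    rw [hT]
    exact h4.symm.trans (Filter.EventuallyEq.fderiv_eq h1)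
  -- Since `φ_{λ₂}` is `C`-Lipschitz, its inverse contracts distances by at most `C`, and so does
  -- the derivative of that inverse; composition inherits the bound.
  have hlow : ∀ p ∈ D₁, ∀ᶠ ε in small, ∀ v, ‖v‖ ≤
      C * ‖T (fderiv ℝ (A.chart (l₂ ε)).symm (g ε (p ε))) v‖ := fun p hp => by
    filter_upwards [hb₂ _ (hmaps p hp)] with ε h1 v
    refine v.opNorm_le_bound (by positivity) fun w => ?_
    have h2 := norm_le_norm_fderiv_of_norm_sub_le (C := C)
      ((A.contDiffAt_symm (α := l₂ ε) h1).differentiableAt (by simp)) (by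
        filter_upwards [Metric.isOpen_ball.mem_nhds h1] with y hy
        have h3 := (hC ε).1 _ (A.symm_mem_source hy) _ (A.symm_mem_source h1)
        rwa [A.chart_symm_apply hy, A.chart_symm_apply h1] at h3) (v w)
    refine h2.trans ?_
    rw [mul_assoc, hT]
    exact mul_le_mul_of_nonneg_left
      (((fderiv ℝ (A.chart (l₂ ε)).symm (g ε (p ε))).comp v).le_opNorm w) hC0.le
  -- Bootstrap: `g` is bounded by `r`; order `k` for `g` gives order `k` for the coefficient
  -- `D(φ_{λ₂}⁻¹) ∘ g`, and the linear equation then gives order `k` for `Dg`.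
  have hmg : ∀ k, NetModerate D₁ k g := fun k => by
    have h0 : ∀ p ∈ D₁, IsModerate (fun ε => ‖g ε (p ε)‖) := fun p hp =>
      isModerate_of_norm_le r ((hb₂ _ (hmaps p hp)).mono fun ε h => (mem_ball_zero_iff.1 h).le)
    induction k with
    | zero => exact h0
    | succ k ih =>
      have hmE := NetModerate.comp hD₁ ih (hm₂ (k + 1)).2 hsg hs₂.fderiv_net hmaps
      have hmT := NetModerate.clm
        (G := (EuclideanSpace ℝ (Fin n) →L[ℝ] EuclideanSpace ℝ (Fin n)) →L[ℝ]
          EuclideanSpace ℝ (Fin n) →L[ℝ] EuclideanSpace ℝ (Fin N)) hD₁ T hmE hsE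
      exact ⟨h0, NetModerate.of_apply_eq hD₁ hmT (hm₁ (k + 1)).2 hsT
        hs₁.fderiv_net hsg.fderiv_net heq hC0.le hlow⟩
  refine genContDiffOn_of_isRep hS₁ hsg hmg ?_ k
  rintro _ ⟨x, hx, rfl⟩ p hp
  rw [hf x hx]
  exact (hgrep x hx p hp).2.2

theorem transition_genChart (hLip : A.IsBiLipschitz) {l₁ : Idx → Λ} (l₂ : Idx → Λ)
    (hl₁ : (Set.range l₁).Finite) {x : GenVec N} (hx : x ∈ A.genDomain l₁) :
    A.transition l₁ l₂ (A.genChart l₁ x) = A.genChart l₂ x := by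
  rw [transition, (injOn_genChart hLip hl₁).leftInvOn_invFunOn hx]

theorem isGenDiffeo_transition (hr : 0 < r) (hLip : A.IsBiLipschitz) {l₁ l₂ : Idx → Λ}
    (hl₁ : (Set.range l₁).Finite) (hl₂ : (Set.range l₂).Finite)
    (hg₁ : ∀ ε, A.HasModerateGrowth (l₁ ε)) (hg₂ : ∀ ε, A.HasModerateGrowth (l₂ ε)) :
    IsGenDiffeo (A.transition l₁ l₂) (A.genChart l₁ '' (A.genDomain l₁ ∩ A.genDomain l₂))
      (A.genChart l₂ '' (A.genDomain l₁ ∩ A.genDomain l₂)) := by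
  have htr : ∀ x ∈ A.genDomain l₁ ∩ A.genDomain l₂,
      A.transition l₁ l₂ (A.genChart l₁ x) = A.genChart l₂ x := fun x hx =>
    transition_genChart hLip l₂ hl₁ hx.1
  have hinj : Set.InjOn (A.transition l₁ l₂)
      (A.genChart l₁ '' (A.genDomain l₁ ∩ A.genDomain l₂)) := by
    rintro _ ⟨x, hx, rfl⟩ _ ⟨y, hy, rfl⟩ h
    rw [htr x hx, htr y hy] at h
    rw [injOn_genChart hLip hl₂ hx.2 hy.2 h]
  refine ⟨isOpen_genChart_image_inter hr hLip hl₁, ?_, ⟨?_, hinj, ?_⟩, fun k =>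
    genContDiffOn_change hr hLip hl₁ hl₂ hg₁ hg₂ htr k, fun k => ?_⟩
  · rw [Set.inter_comm]
    exact isOpen_genChart_image_inter hr hLip hl₂
  · rintro _ ⟨x, hx, rfl⟩
    exact ⟨x, hx, (htr x hx).symm⟩
  · rintro _ ⟨x, hx, rfl⟩
    exact ⟨_, ⟨x, hx, rfl⟩, htr x hx⟩
  -- The inverse is the change of charts with the roles of `l₁` and `l₂` exchanged.
  · have := genContDiffOn_change (f := Function.invFunOn (A.transition l₁ l₂)
      (A.genChart l₁ '' (A.genDomain l₁ ∩ A.genDomain l₂))) hr hLip hl₂ hl₁ hg₂ hg₁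
      (fun x hx => by
        rw [← htr x hx.symm]
        exact hinj.leftInvOn_invFunOn ⟨x, hx.symm, rfl⟩) k
    rwa [Set.inter_comm (A.genDomain l₂)] at this

end SubmanifoldAtlas

/-! ### The generalized manifold structure of `M̃_c` -/

theorem mainTheorem6 (N n : ℕ) (r : ℝ) (hr : 0 < r) (M : Set (EuclideanSpace ℝ (Fin N)))
    {Λ : Type*} (A : SubmanifoldAtlas M n r Λ) (hLip : A.IsBiLipschitz) :
    -- the charts induce on `M̃_c` the topology of `ℝ̄ᴺ`
    (∀ τ : TopologicalSpace (compactPoints M),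
      A.IsChartTopology τ ↔ τ = instTopologicalSpaceSubtype) ∧
    -- `U_λ` is an open subset of `M̃_c`
    (∀ l : Idx → Λ, (Set.range l).Finite →
      A.genDomain l ⊆ compactPoints M ∧
      IsOpen (Subtype.val ⁻¹' A.genDomain l : Set (compactPoints M))) ∧
    -- `⟨Ω₀⟩` is an open subset of `ℝ̄ⁿ` contained in `ℝ̃ⁿ_c`
    (stronglyInternal Set.univ (fun _ => Metric.ball (0 : EuclideanSpace ℝ (Fin n)) r) ⊆
        compactPoints Set.univ ∧
      IsOpen (stronglyInternal Set.univ
        (fun _ => Metric.ball (0 : EuclideanSpace ℝ (Fin n)) r))) ∧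
    -- `φ_λ` is well defined and isometric from `U_λ` into `⟨Ω₀⟩`, and it is onto `⟨Ω₀⟩` when the
    -- chart domains involved are relatively compact in `M`
    (∀ l : Idx → Λ, (Set.range l).Finite →
      (∀ x ∈ A.genDomain l, ∀ p : Net N, IsRep p x → (∀ᶠ ε in small, p ε ∈ M) →
        IsRep (fun ε => A.chart (l ε) (p ε)) (A.genChart l x)) ∧
      Set.MapsTo (A.genChart l) (A.genDomain l)
        (stronglyInternal Set.univ (fun _ => Metric.ball 0 r)) ∧
      (∀ x ∈ A.genDomain l, ∀ y ∈ A.genDomain l,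
        sharpNorm (A.genChart l x - A.genChart l y) = sharpNorm (x - y)) ∧
      ((∀ ε, A.IsRelCompact (l ε)) →
        A.genChart l '' A.genDomain l =
          stronglyInternal Set.univ (fun _ => Metric.ball 0 r))) ∧
    -- the `U_λ`, with `λ` of finite range, cover `M̃_c`
    (compactPoints M = ⋃ l ∈ {l : Idx → Λ | (Set.range l).Finite}, A.genDomain l) ∧
    -- the changes of charts are `C^∞` diffeomorphisms when the inverses of the charts involved have
    -- derivatives of moderate growth
    (∀ l₁ l₂ : Idx → Λ, (Set.range l₁).Finite → (Set.range l₂).Finite →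
      (∀ ε, A.HasModerateGrowth (l₁ ε)) → (∀ ε, A.HasModerateGrowth (l₂ ε)) →
      IsGenDiffeo (A.transition l₁ l₂)
        (A.genChart l₁ '' (A.genDomain l₁ ∩ A.genDomain l₂))
        (A.genChart l₂ '' (A.genDomain l₁ ∩ A.genDomain l₂))) := by
  exact ⟨SubmanifoldAtlas.isChartTopology_iff hr hLip,
    fun l _ => ⟨fun x hx => hx.1, A.isOpen_preimage_genDomain l⟩,
    ⟨fun x hx => hx.1, isOpen_stronglyInternal_univ _⟩,
    fun l hl => ⟨fun x hx p hp hpM => SubmanifoldAtlas.isRep_genChart hLip hl hx hp hpM,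
      SubmanifoldAtlas.mapsTo_genChart hr hLip hl,
      fun x hx y hy => SubmanifoldAtlas.sharpNorm_genChart_sub hLip hl hx hy,
      fun hc => SubmanifoldAtlas.genChart_image_eq hr hLip hl hc⟩,
    A.compactPoints_eq_iUnion,
    fun l₁ l₂ hl₁ hl₂ hg₁ hg₂ =>
      SubmanifoldAtlas.isGenDiffeo_transition hr hLip hl₁ hl₂ hg₁ hg₂⟩
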